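/- Let $G$ be a finite abelian group of order $n$. A subset $A\subseteq G$ is sum-free if there are no $x,y,z\in A$ (not necessarily distinct) with $x+y=z$. Write $\mathrm{SF}(G)$ for the set of all sum-free subsets of $G$, and $\mu(G)$ for the density of the largest sum-free subset of $G$, so that this subset has size $\mu(G)n$. For a prime $p=3k+2$ we say that $G$ is of type I($p$) if $p$ is the least prime factor of $n$ that is congruent to $2$ modulo $3$. Theorem 3. Let $p=3k+2$ be prime, and put $W=1$ if $p=2$ and $W=1/2$ otherwise. For every $\varepsilon>0$ there is $N=N(p,\varepsilon)$ such that every finite abelian group $G$ of type I($p$) and order $n\ge N$ satisfies $$\Bigl|\,|\mathrm{SF}(G)|-W\cdot\#\{g\in G: g\text{ has order }p\}\cdot 2^{\mu(G)n}\Bigr|\le \varepsilon\, W\cdot\#\{g\in G: g\text{ has order }p\}\cdot 2^{\mu(G)n},$$ that is, $|\mathrm{SF}(G)|=W\cdot\#\{\text{elements of order }p\}\cdot2^{\mu(G)n}(1+o_p(1))$; and all but at most $\varepsilon\,2^{\mu(G)n}$ of the sum-free subsets $A$ of $G$ are contained in $\psi^{-1}(\{k+1,\dots,2k+1\})$ for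 some homomorphism $\psi:G\to\mathbb{Z}/p\mathbb{Z}$ (depending on $A$). -/

import Mathlib

/-- `A` is sum-free: `x + y = z` has no solution with `x, y, z ∈ A` (`x = y` is allowed). -/
def IsSumFree {G : Type*} [Add G] (A : Finset G) : Prop :=
  ∀ x ∈ A, ∀ y ∈ A, x + y ∉ A

open Classical in
/-- The family of all sum-free subsets of `G`. -/
noncomputable def sumFreeSets (G : Type*) [Add G] [Fintype G] : Finset (Finset G) :=
  Finset.univ.filter fun A => IsSumFree A

/-- The density of the largest sum-free subset of `G`. -/
noncomputable def sumFreeDensity (G : Type*) [Add G] [Fintype G] : ℝ :=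
  (((sumFreeSets G).sup Finset.card : ℕ) : ℝ) / (Fintype.card G : ℝ)

/-- `p` is the least prime factor of `|G|` that is congruent to `2` modulo `3`. -/
def IsTypeI (p : ℕ) (G : Type*) [Fintype G] : Prop :=
  IsLeast {q : ℕ | q.Prime ∧ q % 3 = 2 ∧ q ∣ Fintype.card G} p

/-- The set of residues `{k + 1, …, 2k + 1}` in `ℤ/pℤ`. -/
def middleResidues (p k : ℕ) : Finset (ZMod p) :=
  (Finset.Icc (k + 1) (2 * k + 1)).image fun j : ℕ => (j : ZMod p)

open Classical in
/-- The number of elements of (exact) order `p` in `G`. -/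
noncomputable def numOrder (p : ℕ) (G : Type*) [AddMonoid G] [Fintype G] : ℕ :=
  (Finset.univ.filter fun g : G => addOrderOf g = p).card

open Classical in
/-- The sum-free subsets of `G` that are contained in no `ψ⁻¹({k + 1, …, 2k + 1})` with
`ψ : G → ℤ/pℤ` a homomorphism. -/
noncomputable def exceptionalSumFreeSets (p k : ℕ) (G : Type*) [AddCommGroup G] [Fintype G] :
    Finset (Finset G) :=
  (sumFreeSets G).filter fun A => ¬ ∃ ψ : G →+ ZMod p, ∀ x ∈ A, ψ x ∈ middleResidues p k

/-! For a nonzero homomorphism `ψ : G →+ ZMod p` the preimage of the middle residues is sum-free of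
size `s = (k + 1) n / p`. No sum-free set is larger, so each preimage contributes `2 ^ s` subsets.
Nonzero homomorphisms are as numerous as elements of order `p`, and two of them share a preimage
exactly when they agree up to sign, which explains `W`. Distinct preimages differ in at least `n / p
^ 2` points, so the overlaps among these at most `n` families of subsets are exponentially
negligible. What remains is to show that exceptional sum-free sets are few.

Every sum-free set lies in one of at most `2 ^ (γ n)` containers, each with few solutions of `x + y
= z` (`exists_containers`). Containers of size at most `s - η n` have too few subsets to matter. By
the removal lemma, a larger container becomes a sum-free set `B` of nearly maximal size after
deleting a small proportion of `G`. Stability (`IsSumFree.exists_hom`) places `B` inside a preimage: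
by Kneser's theorem a sum-free set of density above `1/3` comes from a quotient of order `m ≡ 2 (mod
3)` and has density at most `(m + 1) / (3 m)`, so near-maximal density forces `m = p`, and Vosper's
theorem shows that the extremal sum-free sets of `ZMod p` are dilates of intervals.

An exceptional set in a large container therefore lies in some preimage `S` up to a few elements,
among them some `x ∉ S`. Its trace on `S` contains no pair `{y, y + x}`, and `S` contains linearly
many disjoint pairs of this kind, so only an exponentially small proportion of the subsets of `S`
can occur (`card_sumFree_near_le`). This gain outweighs the number of choices for the few elements
outside `S`. -/

open Finset
open scoped Pointwise

/-! ### Kneser's addition theorem, by DeVos's method of convergents -/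

section Kneser

set_option linter.unusedSectionVars false

open Classical

variable {G : Type*} [AddCommGroup G] [Fintype G]

/-- The union of the cosets of `K` that meet `A`. -/
noncomputable def cosetHull (K : AddSubgroup G) (A : Finset G) : Finset G :=
  Finset.univ.filter fun x => ∃ a ∈ A, x - a ∈ K

/-- `A` is a union of cosets of `K`. -/
def IsPeriodic (K : AddSubgroup G) (A : Finset G) : Prop :=
  ∀ a ∈ A, ∀ g ∈ K, a + g ∈ A

/-- The subgroup of periods of `A`. -/
def periodSubgroup (A : Finset G) : AddSubgroup G where
  carrier := {g | ∀ x, x + g ∈ A ↔ x ∈ A}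
  zero_mem' := by simp
  add_mem' := by
    intro g h hg hh x
    rw [← add_assoc, hh, hg]
  neg_mem' := by
    intro g hg x
    simpa using (hg (x + -g)).symm

theorem mem_cosetHull {K : AddSubgroup G} {A : Finset G} {x : G} :
    x ∈ cosetHull K A ↔ ∃ a ∈ A, x - a ∈ K := by
  simp [cosetHull]

theorem mem_cosetHull_singleton {K : AddSubgroup G} {a x : G} :
    x ∈ cosetHull K {a} ↔ x - a ∈ K := by
  simp [cosetHull]

theorem subset_cosetHull (K : AddSubgroup G) (A : Finset G) : A ⊆ cosetHull K A :=
  fun a ha => mem_cosetHull.2 ⟨a, ha, by simp [K.zero_mem]⟩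

theorem cosetHull_mono {K L : AddSubgroup G} {A B : Finset G} (hKL : K ≤ L) (hAB : A ⊆ B) :
    cosetHull K A ⊆ cosetHull L B := by
  intro x hx
  obtain ⟨a, ha, h⟩ := mem_cosetHull.1 hx
  exact mem_cosetHull.2 ⟨a, hAB ha, hKL h⟩

theorem isPeriodic_cosetHull (K : AddSubgroup G) (A : Finset G) :
    IsPeriodic K (cosetHull K A) := by
  intro x hx g hg
  obtain ⟨a, ha, h⟩ := mem_cosetHull.1 hx
  refine mem_cosetHull.2 ⟨a, ha, ?_⟩
  have := K.add_mem h hg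
  rwa [show x - a + g = x + g - a by abel] at this

theorem cosetHull_subset {K : AddSubgroup G} {A B : Finset G} (hB : IsPeriodic K B)
    (hAB : A ⊆ B) : cosetHull K A ⊆ B := by
  intro x hx
  obtain ⟨a, ha, h⟩ := mem_cosetHull.1 hx
  have := hB a (hAB ha) _ h
  simpa using this

theorem isPeriodic_periodSubgroup (A : Finset G) : IsPeriodic (periodSubgroup A) A :=
  fun a ha g hg => ((show ∀ x, x + g ∈ A ↔ x ∈ A from hg) a).2 ha

theorem IsPeriodic.le_periodSubgroup {K : AddSubgroup G} {A : Finset G} (h : IsPeriodic K A) :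
    K ≤ periodSubgroup A := by
  intro g hg x
  refine ⟨fun hx => ?_, fun hx => h x hx g hg⟩
  simpa using h _ hx (-g) (K.neg_mem hg)

theorem IsPeriodic.mono {K L : AddSubgroup G} {A : Finset G} (h : IsPeriodic K A) (hL : L ≤ K) :
    IsPeriodic L A :=
  fun a ha g hg => h a ha g (hL hg)

theorem card_cosetHull_singleton (K : AddSubgroup G) (a : G) :
    (cosetHull K {a}).card = Nat.card K := by
  rw [← Set.ncard_coe_finset]
  have : ((cosetHull K {a} : Finset G) : Set G) = (fun x => a + x) '' (K : Set G) := by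
    ext x
    simp only [mem_cosetHull_singleton, Set.mem_image, SetLike.mem_coe]
    exact ⟨fun h => ⟨x - a, h, by abel⟩, by rintro ⟨y, hy, rfl⟩; simpa using hy⟩
  rw [this, Set.ncard_image_of_injective _ (add_right_injective a)]
  rfl

theorem natCard_le_of_le {K L : AddSubgroup G} (h : K ≤ L) : Nat.card K ≤ Nat.card L :=
  Nat.card_le_card_of_injective _ (AddSubgroup.inclusion_injective h)

theorem cosetHull_add_cosetHull {K : AddSubgroup G} {A B : Finset G} (h : IsPeriodic K (A + B)) :
    cosetHull K A + cosetHull K B = A + B := by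
  refine Subset.antisymm ?_ (add_subset_add (subset_cosetHull _ _) (subset_cosetHull _ _))
  intro x hx
  obtain ⟨y, hy, z, hz, rfl⟩ := mem_add.1 hx
  obtain ⟨a, ha, h1⟩ := mem_cosetHull.1 hy
  obtain ⟨b, hb, h2⟩ := mem_cosetHull.1 hz
  have := h (a + b) (add_mem_add ha hb) _ (K.add_mem h1 h2)
  rwa [show a + b + (y - a + (z - b)) = y + z by abel] at this

theorem add_cosetHull {K : AddSubgroup G} {A B : Finset G} (h : IsPeriodic K (A + B)) :
    A + cosetHull K B = A + B :=
  Subset.antisymm ((add_subset_add_right (subset_cosetHull _ _)).trans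
    (cosetHull_add_cosetHull h).subset) (add_subset_add_left (subset_cosetHull _ _))

theorem card_cosetHull_inter_add {K L : AddSubgroup G} {R : Finset G} (hR : IsPeriodic L R)
    (q : G) {g : G} (hg : g ∈ L) :
    (cosetHull K {q + g} ∩ R).card = (cosetHull K {q} ∩ R).card := by
  have : cosetHull K {q + g} ∩ R = (cosetHull K {q} ∩ R).map (addRightEmbedding g) := by
    ext x
    simp only [mem_inter, mem_cosetHull_singleton, mem_map, addRightEmbedding_apply]
    constructor
    · rintro ⟨h1, h2⟩
      refine ⟨x - g, ⟨by rwa [sub_sub, add_comm g q], ?_⟩, by abel⟩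
      simpa [sub_eq_add_neg] using hR x h2 _ (L.neg_mem hg)
    · rintro ⟨y, ⟨h1, h2⟩, rfl⟩
      exact ⟨by rwa [add_sub_add_right_eq_sub], hR y h2 g hg⟩
  rw [this, card_map]

/-- If `q` lies outside a `K`-periodic set `P` and an `L`-periodic set `R`, while its `L`-coset
meets `P` and its `K`-coset meets `R`, then `P` and `R` are far from being complementary. -/
theorem card_add_card_le_of_crossing {K L : AddSubgroup G} {P R U : Finset G}
    (hP : IsPeriodic K P) (hR : IsPeriodic L R) {q : G} (hqP : q ∉ P) (hqR : q ∉ R)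
    {g h : G} (hg : g ∈ K) (hh : h ∈ L) (hgR : q + g ∈ R) (hhP : q + h ∈ P)
    (hKU : cosetHull K {q} ⊆ U) (hLU : cosetHull L {q} ⊆ U) :
    Nat.card K + Nat.card L ≤
      (U \ (P ∪ R)).card + (P ∩ R).card + 2 * Nat.card (K ⊓ L : AddSubgroup G) := by
  -- Translation by `h` preserves `R` and carries the `K`-coset of `q` into `P`, so the part of that
  -- coset lying in `R` has a copy inside `P ∩ R`; columns are treated symmetrically. A row and a
  -- column overlap in at most a coset of `K ⊓ L`, once outside `P ∪ R` and once inside `P ∩ R`.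
  have row : (cosetHull K {q} \ R).card + (cosetHull K {q + h} ∩ R).card = Nat.card K := by
    rw [card_cosetHull_inter_add hR q hh, card_sdiff_add_card_inter, card_cosetHull_singleton]
  have col : (cosetHull L {q} \ P).card + (cosetHull L {q + g} ∩ P).card = Nat.card L := by
    rw [card_cosetHull_inter_add hP q hg, card_sdiff_add_card_inter, card_cosetHull_singleton]
  have h1 : (cosetHull K {q} \ R) ∪ (cosetHull L {q} \ P) ⊆ U \ (P ∪ R) := by
    intro x hx
    simp only [mem_union, mem_sdiff, mem_cosetHull_singleton, not_or] at hx ⊢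
    rcases hx with ⟨hx, hx'⟩ | ⟨hx, hx'⟩
    · refine ⟨hKU (mem_cosetHull_singleton.2 hx), fun hxP => hqP ?_, hx'⟩
      simpa using hP x hxP _ (K.neg_mem hx)
    · refine ⟨hLU (mem_cosetHull_singleton.2 hx), hx', fun hxR => hqR ?_⟩
      simpa using hR x hxR _ (L.neg_mem hx)
  have h2 : (cosetHull K {q + h} ∩ R) ∪ (cosetHull L {q + g} ∩ P) ⊆ P ∩ R := by
    refine union_subset (inter_subset_inter_right ?_) ?_
    · exact cosetHull_subset hP (by simpa using hhP)
    · rw [inter_comm]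
      exact inter_subset_inter_left (cosetHull_subset hR (by simpa using hgR))
  have h3 : (cosetHull K {q} \ R) ∩ (cosetHull L {q} \ P) ⊆ cosetHull (K ⊓ L) {q} := by
    intro x hx
    simp only [mem_inter, mem_sdiff, mem_cosetHull_singleton] at hx ⊢
    exact ⟨hx.1.1, hx.2.1⟩
  have h4 : (cosetHull K {q + h} ∩ R) ∩ (cosetHull L {q + g} ∩ P) ⊆
      cosetHull (K ⊓ L) {q + g + h} := by
    intro x hx
    simp only [mem_inter, mem_cosetHull_singleton] at hx ⊢
    refine ⟨?_, ?_⟩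
    · rw [show x - (q + g + h) = x - (q + h) - g by abel]
      exact K.sub_mem hx.1.1 hg
    · rw [show x - (q + g + h) = x - (q + g) - h by abel]
      exact L.sub_mem hx.2.1 hh
  have c1 := card_le_card h1
  have c2 := card_le_card h2
  have c3 := card_le_card h3
  have c4 := card_le_card h4
  rw [card_cosetHull_singleton] at c3 c4
  have u1 := card_union_add_card_inter (cosetHull K {q} \ R) (cosetHull L {q} \ P)
  have u2 := card_union_add_card_inter (cosetHull K {q + h} ∩ R) (cosetHull L {q + g} ∩ P)
  omega

/-- The conclusion of Kneser's theorem, with the sets themselves in place of their hulls. -/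
def KneserBound (A B : Finset G) : Prop :=
  ∃ K : AddSubgroup G, IsPeriodic K (A + B) ∧ A.card + B.card ≤ (A + B).card + Nat.card K

/-- The conclusion of Kneser's theorem. -/
def StrongKneserBound (A B : Finset G) : Prop :=
  ∃ K : AddSubgroup G, IsPeriodic K (A + B) ∧
    (cosetHull K A).card + (cosetHull K B).card ≤ (A + B).card + Nat.card K

/-- Passing to hulls under the full period group of `A + B` does not change the sum, so the weak
bound for the hulls is nearly the strong bound for `A` and `B`. The subgroup it produces may be
enlarged to the whole period group. -/
theorem StrongKneserBound.of_forall {A B : Finset G}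
    (h : ∀ A' B' : Finset G, A ⊆ A' → B ⊆ B' → A' + B' = A + B → KneserBound A' B') :
    StrongKneserBound A B := by
  have hp := isPeriodic_periodSubgroup (A + B)
  have hs := cosetHull_add_cosetHull hp
  obtain ⟨K, hK, hc⟩ := h _ _ (subset_cosetHull _ _) (subset_cosetHull _ _) hs
  rw [hs] at hK hc
  exact ⟨_, hp, hc.trans (Nat.add_le_add_left (natCard_le_of_le hK.le_periodSubgroup) _)⟩

/-- A `K`-periodic part `C` of `A + B` that is large in terms of `A ∩ B` and `A ∪ B`. -/
def IsConvergent (A B C : Finset G) (K : AddSubgroup G) : Prop :=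
  C ⊆ A + B ∧ C.Nonempty ∧ IsPeriodic K C ∧
    (A ∩ B).card + (cosetHull K (A ∪ B)).card ≤ C.card + Nat.card K

/-- A coset of `K` not contained in `A + B` is disjoint from the periodic set `C`, so the sum `A' +
B'` of the local pieces can be adjoined to `C`. Induction makes `A' + B'` periodic under a proper
subgroup `K₁` of `K`. By minimality of `K` the enlarged set is not convergent for any `L ≤ K₁`;
comparing this failure with the convergence of `C` gives the inequality. -/
theorem IsConvergent.exists_subgroup_lt {A B C : Finset G} {K : AddSubgroup G}
    (hC : IsConvergent A B C K)
    (hmin : ∀ C' L, IsConvergent A B C' L → Nat.card K ≤ Nat.card L)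
    (ih : ∀ A' B' : Finset G, A'.Nonempty → B'.Nonempty → (A' + B').card < (A + B).card →
      StrongKneserBound A' B')
    {a b x : G} (hx : x ∈ cosetHull K {a + b}) (hxAB : x ∉ A + B)
    (hA : (A ∩ cosetHull K {a}).Nonempty) (hB : (B ∩ cosetHull K {b}).Nonempty) :
    ∃ K₁ ≤ K, ∀ L ≤ K₁, (cosetHull K₁ (A ∩ cosetHull K {a})).card +
      (cosetHull K₁ (B ∩ cosetHull K {b})).card + Nat.card L +
      (cosetHull K (A ∪ B) \ cosetHull L (A ∪ B)).card < Nat.card K + Nat.card K₁ := by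
  obtain ⟨hCAB, hCne, hCper, hCcard⟩ := hC
  set A' := A ∩ cosetHull K {a} with hA'
  set B' := B ∩ cosetHull K {b} with hB'
  have hsub : A' + B' ⊆ A + B := add_subset_add inter_subset_left inter_subset_left
  have hsubK : A' + B' ⊆ cosetHull K {a + b} := by
    intro y hy
    obtain ⟨u, hu, v, hv, rfl⟩ := mem_add.1 hy
    rw [mem_cosetHull_singleton, add_sub_add_comm]
    exact K.add_mem (mem_cosetHull_singleton.1 (mem_inter.1 hu).2)
      (mem_cosetHull_singleton.1 (mem_inter.1 hv).2)
  have hdisj : Disjoint C (A' + B') := by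
    rw [Finset.disjoint_left]
    intro c hc hc'
    apply hxAB
    apply hCAB
    have h1 := mem_cosetHull_singleton.1 (hsubK hc')
    have h2 := mem_cosetHull_singleton.1 hx
    have := hCper c hc _ (K.sub_mem h2 h1)
    rwa [show c + (x - (a + b) - (c - (a + b))) = x by abel] at this
  have hCcardpos := hCne.card_pos
  have hlt : (A' + B').card < (A + B).card := by
    have := card_le_card (union_subset hCAB hsub)
    rw [card_union_of_disjoint hdisj] at this
    omega
  obtain ⟨K₁, hper, hcard⟩ := ih A' B' hA hB hlt
  obtain ⟨s, hs⟩ := hA.add hB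
  have hle : K₁ ≤ K := by
    intro g hg
    have h1 := mem_cosetHull_singleton.1 (hsubK (hper s hs g hg))
    have h2 := mem_cosetHull_singleton.1 (hsubK hs)
    have := K.sub_mem h1 h2
    rwa [show s + g - (a + b) - (s - (a + b)) = g by abel] at this
  have hKlt : Nat.card K₁ < Nat.card K := by
    by_contra hcon
    have heq : K₁ = K := AddSubgroup.eq_of_le_of_card_ge hle (not_lt.1 hcon)
    apply hxAB
    apply hsub
    have h1 := mem_cosetHull_singleton.1 (hsubK hs)
    have h2 := mem_cosetHull_singleton.1 hx
    have := hper s hs (x - s) (heq ▸ (by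
      have := K.sub_mem h2 h1
      rwa [show x - (a + b) - (s - (a + b)) = x - s by abel] at this))
    simpa using this
  refine ⟨K₁, hle, fun L hL => ?_⟩
  have hnot : ¬ IsConvergent A B (C ∪ (A' + B')) L := fun hcon =>
    absurd (hmin _ _ hcon) (by have := natCard_le_of_le hL; omega)
  have hineq : (C ∪ (A' + B')).card + Nat.card L <
      (A ∩ B).card + (cosetHull L (A ∪ B)).card := by
    by_contra hcon
    refine hnot ⟨union_subset hCAB hsub, hCne.mono subset_union_left, ?_, not_lt.1 hcon⟩
    intro y hy g hg
    rcases mem_union.1 hy with hy | hy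
    · exact mem_union_left _ (hCper y hy g (hle (hL hg)))
    · exact mem_union_right _ (hper y hy g (hL hg))
  rw [card_union_of_disjoint hdisj] at hineq
  have := card_sdiff_add_card_eq_card
    (cosetHull_mono (hL.trans hle) (Subset.refl (A ∪ B)))
  omega

theorem cosetHull_inter_coset_subset {K K₁ K₂ L : AddSubgroup G} (A B : Finset G) (a : G)
    (hLK : L ≤ K) (h₁ : L ≤ K₁) (h₂ : L ≤ K₂) :
    cosetHull K {a} \ (cosetHull K₁ (A ∩ cosetHull K {a}) ∪
      cosetHull K₂ (B ∩ cosetHull K {a})) ⊆ cosetHull K {a} \ cosetHull L (A ∪ B) := by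
  intro x hx
  obtain ⟨hxU, hx⟩ := mem_sdiff.1 hx
  refine mem_sdiff.2 ⟨hxU, fun hxL => hx ?_⟩
  obtain ⟨d, hd, hxd⟩ := mem_cosetHull.1 hxL
  have hdU : d ∈ cosetHull K {a} := by
    rw [mem_cosetHull_singleton] at hxU ⊢
    have := K.sub_mem hxU (hLK hxd)
    rwa [show x - a - (x - d) = d - a by abel] at this
  rcases mem_union.1 hd with hd | hd
  · exact mem_union_left _ (mem_cosetHull.2 ⟨d, mem_inter.2 ⟨hd, hdU⟩, h₁ hxd⟩)
  · exact mem_union_right _ (mem_cosetHull.2 ⟨d, mem_inter.2 ⟨hd, hdU⟩, h₂ hxd⟩)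

theorem card_coset_le {K K₁ : AddSubgroup G} (A B : Finset G) (a : G) (h : K₁ ≤ K) :
    Nat.card K ≤ (cosetHull K {a} \ cosetHull K₁ (A ∪ B)).card +
      (cosetHull K₁ (A ∩ cosetHull K {a})).card +
      (cosetHull K₁ (B ∩ cosetHull K {a}) \ cosetHull K₁ (A ∩ cosetHull K {a})).card := by
  have h1 := card_le_card (cosetHull_inter_coset_subset A B a h le_rfl le_rfl)
  have h2 := le_card_sdiff (cosetHull K₁ (A ∩ cosetHull K {a}) ∪
      cosetHull K₁ (B ∩ cosetHull K {a})) (cosetHull K {a})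
  have h3 := card_sdiff_add_card (cosetHull K₁ (B ∩ cosetHull K {a}))
    (cosetHull K₁ (A ∩ cosetHull K {a}))
  rw [card_cosetHull_singleton] at h2
  rw [union_comm] at h3
  omega

theorem cosetHull_inter_coset_subset_coset {K K₁ : AddSubgroup G} (A : Finset G) (a : G)
    (h : K₁ ≤ K) : cosetHull K₁ (A ∩ cosetHull K {a}) ⊆ cosetHull K {a} :=
  cosetHull_subset ((isPeriodic_cosetHull K {a}).mono h) inter_subset_right

/-- The contribution of one coset of `K` to the final inequality in Kneser's theorem. -/
theorem card_coset_le_two_mul {K K₁ K₂ : AddSubgroup G} (A B : Finset G) (a : G) (h₁ : K₁ ≤ K)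
    (h₂ : K₂ ≤ K) :
    Nat.card K ≤ 2 * (cosetHull K {a} \ cosetHull (K₁ ⊓ K₂) (A ∪ B)).card +
      (cosetHull K₁ (A ∩ cosetHull K {a})).card + (cosetHull K₂ (B ∩ cosetHull K {a})).card ∧
    (((cosetHull K₁ (B ∩ cosetHull K {a}) \ cosetHull K₁ (A ∩ cosetHull K {a})) ∩
      (cosetHull K₂ (A ∩ cosetHull K {a}) \ cosetHull K₂ (B ∩ cosetHull K {a}))).Nonempty →
    Nat.card K + Nat.card K₁ + Nat.card K₂ ≤
      2 * (cosetHull K {a} \ cosetHull (K₁ ⊓ K₂) (A ∪ B)).card +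
      (cosetHull K₁ (A ∩ cosetHull K {a})).card + (cosetHull K₂ (B ∩ cosetHull K {a})).card +
      2 * Nat.card (K₁ ⊓ K₂ : AddSubgroup G)) := by
  set U := cosetHull K {a} with hU
  set P := cosetHull K₁ (A ∩ U) with hP
  set R := cosetHull K₂ (B ∩ U) with hR
  have hPU : P ⊆ U := cosetHull_inter_coset_subset_coset A a h₁
  have hRU : R ⊆ U := cosetHull_inter_coset_subset_coset B a h₂
  have c1 := card_le_card (cosetHull_inter_coset_subset (L := K₁ ⊓ K₂) A B a
    (inf_le_left.trans h₁) inf_le_left inf_le_right)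
  rw [← hU, ← hP, ← hR] at c1
  have c2 := card_sdiff_add_card_eq_card (union_subset hPU hRU)
  have c3 := card_union_add_card_inter P R
  have c4 : U.card = Nat.card K := card_cosetHull_singleton K a
  refine ⟨by omega, ?_⟩
  rintro ⟨q, hq⟩
  obtain ⟨hq1, hq2⟩ := mem_inter.1 hq
  obtain ⟨hqB, hqP⟩ := mem_sdiff.1 hq1
  obtain ⟨hqA, hqR⟩ := mem_sdiff.1 hq2
  have hqU : q ∈ U := cosetHull_inter_coset_subset_coset B a h₁ hqB
  obtain ⟨b', hb', hb⟩ := mem_cosetHull.1 hqB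
  obtain ⟨a', ha', ha⟩ := mem_cosetHull.1 hqA
  have hUper := isPeriodic_cosetHull K {a}
  have := card_add_card_le_of_crossing (U := U) (isPeriodic_cosetHull K₁ (A ∩ U))
    (isPeriodic_cosetHull K₂ (B ∩ U)) hqP hqR (K₁.neg_mem hb) (K₂.neg_mem ha)
    (by simpa using subset_cosetHull K₂ _ hb') (by simpa using subset_cosetHull K₁ _ ha')
    (cosetHull_subset (hUper.mono h₁) (by simpa using hqU))
    (cosetHull_subset (hUper.mono h₂) (by simpa using hqU))
  rw [← hP, ← hR] at this
  omega

/-- If a coset `a + b + K` were only partly filled, the hulls of the local pieces and the holes of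
`A ∪ B` would together be too small to fill `a + K` and `b + K`. One such inequality is
contradictory when these cosets coincide or when a cross piece `B ∩ (a + K)` or `A ∩ (b + K)` is
empty. Otherwise the cross pieces give a second inequality, with a subgroup `K₂`, and the two are
played against each other through the crossing estimate. -/
theorem IsConvergent.isPeriodic_add {A B C : Finset G} {K : AddSubgroup G}
    (hC : IsConvergent A B C K)
    (hmin : ∀ C' L, IsConvergent A B C' L → Nat.card K ≤ Nat.card L)
    (ih : ∀ A' B' : Finset G, A'.Nonempty → B'.Nonempty → (A' + B').card < (A + B).card →
      StrongKneserBound A' B') : IsPeriodic K (A + B) := by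
  intro y hy g hg
  by_contra hx
  obtain ⟨a, ha, b, hb, rfl⟩ := mem_add.1 hy
  have hmem : ∀ u : G, u ∈ cosetHull K {u} := fun u =>
    subset_cosetHull K {u} (mem_singleton_self u)
  have hxK : a + b + g ∈ cosetHull K {a + b} := by
    rw [mem_cosetHull_singleton]
    simpa using hg
  obtain ⟨K₁, hK₁, h1⟩ := hC.exists_subgroup_lt hmin ih hxK hx ⟨a, mem_inter.2 ⟨ha, hmem a⟩⟩
    ⟨b, mem_inter.2 ⟨hb, hmem b⟩⟩
  have hUD : cosetHull K {a} ⊆ cosetHull K (A ∪ B) :=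
    cosetHull_mono le_rfl (by simp [ha])
  have hVD : cosetHull K {b} ⊆ cosetHull K (A ∪ B) :=
    cosetHull_mono le_rfl (by simp [hb])
  have missU : ∀ L, (cosetHull K {a} \ cosetHull L (A ∪ B)).card ≤
      (cosetHull K (A ∪ B) \ cosetHull L (A ∪ B)).card := fun L =>
    card_le_card (sdiff_subset_sdiff hUD le_rfl)
  have missV : ∀ L, (cosetHull K {b} \ cosetHull L (A ∪ B)).card ≤
      (cosetHull K (A ∪ B) \ cosetHull L (A ∪ B)).card := fun L =>
    card_le_card (sdiff_subset_sdiff hVD le_rfl)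
  have h1' := h1 K₁ le_rfl
  have eU := card_coset_le A B a hK₁
  have eV := card_coset_le B A b hK₁
  rw [union_comm B A] at eV
  have mU := missU K₁
  have mV := missV K₁
  have sU := card_le_card (sdiff_subset (s := cosetHull K₁ (B ∩ cosetHull K {a}))
    (t := cosetHull K₁ (A ∩ cosetHull K {a})))
  have sV := card_le_card (sdiff_subset (s := cosetHull K₁ (A ∩ cosetHull K {b}))
    (t := cosetHull K₁ (B ∩ cosetHull K {b})))
  have hempty : (cosetHull K₁ (∅ : Finset G)).card = 0 := by simp [cosetHull]
  by_cases hUV : a - b ∈ K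
  · have : cosetHull K {a} = cosetHull K {b} := by
      ext x
      rw [mem_cosetHull_singleton, mem_cosetHull_singleton, ← sub_add_sub_cancel x a b]
      exact (K.add_mem_cancel_right hUV).symm
    rw [this] at eU mU sU h1'
    omega
  have hdisj : Disjoint (cosetHull K {a}) (cosetHull K {b}) := by
    rw [Finset.disjoint_left]
    intro x hxa hxb
    rw [mem_cosetHull_singleton] at hxa hxb
    apply hUV
    have := K.sub_mem hxb hxa
    rwa [show x - b - (x - a) = a - b by abel] at this
  rcases eq_empty_or_nonempty (B ∩ cosetHull K {a}) with hB2 | hB2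
  · rw [hB2] at sU eU
    rw [hempty] at sU
    omega
  rcases eq_empty_or_nonempty (A ∩ cosetHull K {b}) with hA2 | hA2
  · rw [hA2] at sV eV
    rw [hempty] at sV
    omega
  obtain ⟨K₂, hK₂, h2⟩ := hC.exists_subgroup_lt hmin ih (a := b) (b := a)
    (by rwa [add_comm b a]) hx hA2 hB2
  have miss : ∀ L, (cosetHull K {a} \ cosetHull L (A ∪ B)).card +
      (cosetHull K {b} \ cosetHull L (A ∪ B)).card ≤
      (cosetHull K (A ∪ B) \ cosetHull L (A ∪ B)).card := fun L => by
    rw [← card_union_of_disjoint (hdisj.mono sdiff_subset sdiff_subset)]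
    exact card_le_card (union_subset (sdiff_subset_sdiff hUD le_rfl)
      (sdiff_subset_sdiff hVD le_rfl))
  have h2' := h2 K₂ le_rfl
  have fU := card_coset_le B A a hK₂
  have fV := card_coset_le A B b hK₂
  rw [union_comm B A] at fU
  have m1 := miss K₁
  have m2 := miss K₂
  have m3 := miss (K₁ ⊓ K₂)
  have g1 := h1 (K₁ ⊓ K₂) inf_le_left
  have g2 := h2 (K₁ ⊓ K₂) inf_le_right
  obtain ⟨zU, wU⟩ := card_coset_le_two_mul A B a hK₁ hK₂
  obtain ⟨zV, wV⟩ := card_coset_le_two_mul B A b hK₁ hK₂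
  rw [union_comm B A] at zV wV
  have pigeon : ∀ {c : G} {X Y : Finset G}, X ⊆ cosetHull K {c} → Y ⊆ cosetHull K {c} →
      Nat.card K < X.card + Y.card → (X ∩ Y).Nonempty := by
    intro c X Y hX hY hlt
    rw [← card_cosetHull_singleton K c] at hlt
    have h := card_le_card (union_subset hX hY)
    have h' := card_union_add_card_inter X Y
    exact card_pos.1 (by omega)
  -- If these two differences exceed `a + K` in total size, they meet in a crossing point. If not,
  -- the inequalities already collected force the analogous excess in `b + K`.
  by_cases hcase : Nat.card K <
      (cosetHull K₁ (B ∩ cosetHull K {a}) \ cosetHull K₁ (A ∩ cosetHull K {a})).card +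
      (cosetHull K₂ (A ∩ cosetHull K {a}) \ cosetHull K₂ (B ∩ cosetHull K {a})).card
  · have := wU (pigeon (sdiff_subset.trans (cosetHull_inter_coset_subset_coset _ _ hK₁))
      (sdiff_subset.trans (cosetHull_inter_coset_subset_coset _ _ hK₂)) hcase)
    omega
  · have := wV (pigeon (sdiff_subset.trans (cosetHull_inter_coset_subset_coset _ _ hK₁))
      (sdiff_subset.trans (cosetHull_inter_coset_subset_coset _ _ hK₂)) (by omega))
    omega

theorem add_singleton_eq_image (A : Finset G) (g : G) : A + {g} = A.image (· + g) := by
  ext x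
  simp only [mem_add, mem_singleton, exists_eq_left, mem_image]

theorem KneserBound.of_inter {A B : Finset G} (hne : (A ∩ B).Nonempty) (hAB : ¬ A ⊆ B)
    (ih : ∀ A' B' : Finset G, A'.Nonempty → B'.Nonempty → (A' + B').card < (A + B).card →
      KneserBound A' B')
    (ih' : ∀ A' B' : Finset G, A'.Nonempty → B'.Nonempty → (A' + B').card ≤ (A + B).card →
      A'.card < A.card → KneserBound A' B') : KneserBound A B := by
  have hlt : (A ∩ B).card < A.card := by
    refine card_lt_card (inter_subset_left.ssubset_of_ne fun h => hAB ?_)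
    exact inter_eq_left.1 h
  have hne' : (A ∪ B).Nonempty := hne.mono (inter_subset_left.trans subset_union_left)
  have hsub : (A ∩ B) + (A ∪ B) ⊆ A + B := inter_add_union_subset
  -- A first convergent comes from `(A ∩ B) + (A ∪ B)`: induction applies because `A ∩ B` is
  -- strictly smaller than `A`. The union is replaced by its hull, with the same sum, since
  -- convergence measures the hull.
  have hconv : ∃ m, ∃ C K, IsConvergent A B C K ∧ Nat.card K = m := by
    set C := (A ∩ B) + (A ∪ B) with hCdef
    have hper := isPeriodic_periodSubgroup C
    have hs := add_cosetHull hper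
    obtain ⟨L, hL, hc⟩ := ih' (A ∩ B) (cosetHull (periodSubgroup C) (A ∪ B)) hne
      (hne'.mono (subset_cosetHull _ _)) (by rw [hs]; exact card_le_card hsub) hlt
    rw [hs] at hL hc
    exact ⟨_, C, periodSubgroup C, ⟨hsub, hne.add hne', hper,
      hc.trans (Nat.add_le_add_left (natCard_le_of_le hL.le_periodSubgroup) _)⟩, rfl⟩
  obtain ⟨C, K, hC, hK⟩ := Nat.find_spec hconv
  have hper := hC.isPeriodic_add
    (fun C' L h => hK ▸ Nat.find_min' hconv ⟨C', L, h, rfl⟩) (fun A' B' hA' hB' h =>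
      StrongKneserBound.of_forall fun A'' B'' hA'' hB'' hs =>
        ih A'' B'' (hA'.mono hA'') (hB'.mono hB'') (hs ▸ h))
  refine ⟨K, hper, ?_⟩
  have h1 := card_le_card hC.1
  have h2 := hC.2.2.2
  have h3 := card_le_card (subset_cosetHull K (A ∪ B))
  have h4 := card_union_add_card_inter A B
  omega

theorem KneserBound.of_translate {A B : Finset G} (g : G) (h : KneserBound A (B + {g})) :
    KneserBound A B := by
  obtain ⟨K, hper, hc⟩ := h
  refine ⟨K, fun y hy k hk => ?_, ?_⟩
  · have := hper (y + g) (by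
      rw [← add_assoc]; exact add_mem_add hy (mem_singleton_self g)) k hk
    rw [← add_assoc, add_right_comm y g k, add_singleton_eq_image, mem_image] at this
    obtain ⟨z, hz, hzy⟩ := this
    rwa [← add_right_cancel hzy]
  · rwa [← add_assoc, add_singleton_eq_image, card_image_of_injective _ (add_left_injective g),
      add_singleton_eq_image, card_image_of_injective _ (add_left_injective g)] at hc

/-- **Kneser's theorem**, with the sets themselves in place of their hulls. -/
theorem kneserBound {A B : Finset G} (hA : A.Nonempty) (hB : B.Nonempty) : KneserBound A B := by
  suffices H : ∀ s m : ℕ, ∀ A B : Finset G, A.Nonempty → B.Nonempty → (A + B).card = s →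
      A.card = m → KneserBound A B from H _ _ A B hA hB rfl rfl
  intro s
  induction s using Nat.strong_induction_on with
  | _ s ihs =>
  intro m
  induction m using Nat.strong_induction_on with
  | _ m ihm =>
  intro A B hA hB hs hm
  by_cases hex : ∃ g : G, (A ∩ (B + {g})).Nonempty ∧ ¬ A ⊆ B + {g}
  · obtain ⟨g, hne, hsub⟩ := hex
    have hcard : (A + (B + {g})).card = s := by
      rw [← add_assoc, add_singleton_eq_image, card_image_of_injective _ (add_left_injective g), hs]
    apply KneserBound.of_translate g
    refine KneserBound.of_inter hne hsub (fun A' B' hA' hB' h => ?_)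
      fun A' B' hA' hB' h h' => ?_
    · rw [hcard] at h
      exact ihs _ h _ A' B' hA' hB' rfl rfl
    · rw [hcard] at h
      rcases h.lt_or_eq with h | h
      · exact ihs _ h _ A' B' hA' hB' rfl rfl
      · exact ihm _ (hm ▸ h') A' B' hA' hB' h rfl
  -- Here every translate of `B` that meets `A` contains `A`. Hence differences of elements of `A`
  -- are periods of `B`, and `A + B` is a translate of `B`.
  · push Not at hex
    have key : ∀ a ∈ A, ∀ a' ∈ A, ∀ b ∈ B, b + (a' - a) ∈ B := by
      intro a ha a' ha' b hb
      have := hex (a - b) ⟨a, mem_inter.2 ⟨ha, by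
        rw [add_singleton_eq_image, mem_image]; exact ⟨b, hb, by abel⟩⟩⟩ ha'
      rw [add_singleton_eq_image, mem_image] at this
      obtain ⟨c, hc, hc'⟩ := this
      rwa [show b + (a' - a) = c by rw [← hc']; abel]
    obtain ⟨a, ha⟩ := hA
    have hsubK : ∀ a' ∈ A, a' - a ∈ periodSubgroup B := by
      intro a' ha' x
      refine ⟨fun hx => ?_, key a ha a' ha' x⟩
      have := key a' ha' a ha _ hx
      rwa [show x + (a' - a) + (a - a') = x by abel] at this
    have hsum : A + B = B + {a} := by
      rw [add_comm A B]
      refine Subset.antisymm ?_ (add_subset_add_left (by simpa using ha))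
      intro y hy
      obtain ⟨b, hb, a', ha', rfl⟩ := mem_add.1 hy
      rw [add_singleton_eq_image, mem_image]
      exact ⟨b + (a' - a), key a ha a' ha' b hb, by abel⟩
    refine ⟨periodSubgroup B, ?_, ?_⟩
    · rw [hsum, add_singleton_eq_image]
      intro y hy g hg
      obtain ⟨b, hb, rfl⟩ := mem_image.1 hy
      exact mem_image.2 ⟨b + g, isPeriodic_periodSubgroup B b hb g hg, by abel⟩
    · rw [hsum, add_singleton_eq_image, card_image_of_injective _ (add_left_injective a), add_comm]
      gcongr
      rw [← card_cosetHull_singleton _ a]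
      exact card_le_card fun a' ha' => mem_cosetHull_singleton.2 (hsubK a' ha')

/-- **Kneser's theorem** for finite abelian groups. -/
theorem strongKneserBound {A B : Finset G} (hA : A.Nonempty) (hB : B.Nonempty) :
    StrongKneserBound A B :=
  StrongKneserBound.of_forall fun _ _ hA' hB' _ => kneserBound (hA.mono hA') (hB.mono hB')

end Kneser

/-! ### Vosper's theorem in `ZMod p` -/

section Vosper

variable {p : ℕ} [Fact p.Prime]

/-- At most one element of `S` leaves `S` under translation by `d`; in `ℤ/pℤ`, for `d ≠ 0`, this
says that `S` is an arithmetic progression with difference `d`. -/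
def IsProgressionWithStep (d : ZMod p) (S : Finset (ZMod p)) : Prop :=
  (S.filter fun x => x + d ∉ S).card ≤ 1

theorem card_filter_add_mem (d : ZMod p) (S : Finset (ZMod p)) :
    (S.filter fun x => x + d ∈ S).card = (S.filter fun x => x - d ∈ S).card := by
  refine card_bij' (fun x _ => x + d) (fun x _ => x - d) ?_ ?_ ?_ ?_ <;> simp +contextual

theorem IsProgressionWithStep.neg {d : ZMod p} {S : Finset (ZMod p)}
    (h : IsProgressionWithStep d S) : IsProgressionWithStep d (-S) := by
  unfold IsProgressionWithStep at h ⊢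
  have h1 := card_filter_add_card_filter_not (s := S) (fun x => x + d ∈ S)
  have h2 := card_filter_add_card_filter_not (s := S) (fun x => x - d ∈ S)
  have h3 := card_filter_add_mem d S
  have h4 : ((-S).filter fun x => x + d ∉ -S).card = (S.filter fun x => x - d ∉ S).card := by
    refine card_bij' (fun x _ => -x) (fun x _ => -x) ?_ ?_ ?_ ?_ <;>
      simp +contextual [sub_eq_add_neg, add_comm]
  omega

/-- The set `B'` of elements of `B` that stay in `B` under `d` loses at most one element, and `(A ∪
(A + d)) + B'` still lies in `A + B`. Cauchy–Davenport then leaves room for only one element of `A +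
d` outside `A`. -/
theorem IsProgressionWithStep.of_add {d : ZMod p} {A B : Finset (ZMod p)} (hA : A.Nonempty)
    (hB : 2 ≤ B.card) (h : IsProgressionWithStep d B) (hAB : (A + B).card + 1 ≤ A.card + B.card)
    (hp : (A + B).card < p) : IsProgressionWithStep d A := by
  unfold IsProgressionWithStep at h ⊢
  set B' := B.filter fun x => x + d ∈ B with hB'
  have h1 := card_filter_add_card_filter_not (s := B) (fun x => x + d ∈ B)
  rw [← hB'] at h1
  have h2 : (A.filter fun x => x + d ∉ A).card = (A.image (· + d) \ A).card := by
    rw [← card_image_of_injective (A.filter fun x => x + d ∉ A) (add_left_injective d)]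
    congr 1
    ext x
    simp only [mem_image, mem_filter, mem_sdiff]
    exact ⟨by rintro ⟨y, ⟨h1, h2⟩, rfl⟩; exact ⟨⟨y, h1, rfl⟩, h2⟩,
      by rintro ⟨⟨y, h1, rfl⟩, h2⟩; exact ⟨y, ⟨h1, h2⟩, rfl⟩⟩
  have h3 : (A ∪ A.image (· + d)) + B' ⊆ A + B := by
    intro z hz
    obtain ⟨x, hx, b, hb, rfl⟩ := mem_add.1 hz
    obtain ⟨hb1, hb2⟩ := mem_filter.1 hb
    rcases mem_union.1 hx with hx | hx
    · exact add_mem_add hx hb1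
    · obtain ⟨a, ha, rfl⟩ := mem_image.1 hx
      rw [add_assoc, add_comm d b]
      exact add_mem_add ha hb2
  have h4 := card_le_card h3
  have h5 := ZMod.cauchy_davenport (Fact.out : p.Prime) (s := A ∪ A.image (· + d)) (t := B')
    (hA.mono subset_union_left) (card_pos.1 (by omega))
  have h6 : (A ∪ A.image (· + d)).card = (A.image (· + d) \ A).card + A.card := by
    rw [card_sdiff_add_card, union_comm]
  rcases min_le_iff.1 h5 with h5 | h5 <;> omega

theorem compl_add_neg_subset (A B : Finset (ZMod p)) : (A + B)ᶜ + -A ⊆ Bᶜ := by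
  intro z hz
  obtain ⟨x, hx, y, hy, rfl⟩ := mem_add.1 hz
  rw [mem_compl] at hx ⊢
  intro hB
  apply hx
  have := add_mem_add (mem_neg'.1 hy) hB
  rwa [show -y + (x + y) = x by ring] at this

/-- Duality for critical pairs: `(A + B)ᶜ - A` misses `B`, so the complement of the sum and `-A`
form a critical pair again. -/
theorem card_compl_add_neg {A B : Finset (ZMod p)} (hB : B.Nonempty)
    (hAB : (A + B).card + 1 ≤ A.card + B.card) (hp : (A + B).card ≤ p) :
    ((A + B)ᶜ + -A).card + 1 ≤ (A + B)ᶜ.card + (-A).card ∧ ((A + B)ᶜ + -A).card < p := by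
  have h := card_le_card (compl_add_neg_subset A B)
  have hB' := hB.card_pos
  have hBp := card_le_univ B
  rw [card_compl] at h
  rw [card_compl, card_neg]
  rw [ZMod.card] at *
  omega

/-- Equal translates have equal sums of elements, and the size of `Z` is invertible modulo `p`. -/
theorem eq_of_image_add_eq {Z : Finset (ZMod p)} (hZ : Z.Nonempty) (hZp : Z.card < p)
    {e f : ZMod p} (h : Z.image (· + e) = Z.image (· + f)) : e = f := by
  have hs : ∑ z ∈ Z, (z + e) = ∑ z ∈ Z, (z + f) := by
    have h1 := sum_image (s := Z) (g := (· + e)) (f := fun x => x) (add_left_injective e).injOn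
    have h2 := sum_image (s := Z) (g := (· + f)) (f := fun x => x) (add_left_injective f).injOn
    rw [← h1, ← h2, h]
  rw [sum_add_distrib, sum_add_distrib, add_right_inj, sum_const, sum_const, nsmul_eq_mul,
    nsmul_eq_mul] at hs
  refine mul_left_cancel₀ ?_ hs
  rw [Ne, ZMod.natCast_eq_zero_iff]
  exact fun hd => absurd (Nat.le_of_dvd hZ.card_pos hd) (not_le.2 hZp)

/-- Otherwise each translate of `B` lies in `A` or meets it in at most one point. By
Cauchy–Davenport more than `|B|` shifts `e` give exactly one point, so two of them single out the
same `b ∈ B`. Then `A ∪ (B + e)`, shifted by `b`, fills `A + B` by size for both shifts, and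
removing `A` shows that `B \ {b}` has equal translates by two different amounts. -/
theorem exists_translate_inter_card {A B : Finset (ZMod p)} (hA : 2 ≤ A.card) (hB : 3 ≤ B.card)
    (hAB : (A + B).card + 1 ≤ A.card + B.card) (hp : (A + B).card + 2 ≤ p) :
    ∃ e : ZMod p, 2 ≤ (B.filter fun b => b + e ∈ A).card ∧
      (B.filter fun b => b + e ∈ A).card < B.card := by
  by_contra hcon
  push Not at hcon
  have hprime : p.Prime := Fact.out
  have hAne : A.Nonempty := card_pos.1 (by omega)
  have hBne : B.Nonempty := card_pos.1 (by omega)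
  have hcd := ZMod.cauchy_davenport hprime hAne hBne
  have hAp : A.card + B.card + 1 ≤ p := by
    rcases min_le_iff.1 hcd with h | h <;> omega
  have hE := ZMod.cauchy_davenport hprime hAne hBne.neg
  rw [card_neg] at hE
  set X := (univ : Finset (ZMod p)).filter fun e => ∀ b ∈ B, b + e ∈ A with hX
  have hXcard : X.card ≤ A.card + 1 - B.card := by
    rcases X.eq_empty_or_nonempty with h | h
    · simp [h]
    have h1 := ZMod.cauchy_davenport hprime h hBne
    have h2 : X + B ⊆ A := by
      intro z hz
      obtain ⟨x, hx, b, hb, rfl⟩ := mem_add.1 hz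
      rw [add_comm]
      exact (mem_filter.1 hx).2 b hb
    have h3 := card_le_card h2
    rcases min_le_iff.1 h1 with h | h <;> omega
  have hY : B.card < ((A + -B) \ X).card := by
    have h1 := le_card_sdiff X (A + -B)
    rcases min_le_iff.1 hE with h | h <;> omega
  have hone : ∀ e ∈ (A + -B) \ X, ∃ b, (B.filter fun b => b + e ∈ A) = {b} := by
    intro e he
    obtain ⟨he, heX⟩ := mem_sdiff.1 he
    rw [← card_eq_one]
    have hpos : 0 < (B.filter fun b => b + e ∈ A).card := by
      obtain ⟨a, ha, b, hb, rfl⟩ := mem_add.1 he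
      refine card_pos.2 ⟨-b, mem_filter.2 ⟨mem_neg'.1 hb, ?_⟩⟩
      rwa [show -b + (a + b) = a by ring]
    by_contra hne
    have h1 := hcon e (by omega)
    have h2 := eq_of_subset_of_card_le (filter_subset (fun b => b + e ∈ A) B) h1
    apply heX
    rw [hX, mem_filter]
    refine ⟨mem_univ _, fun b hb => ?_⟩
    rw [← h2] at hb
    exact (mem_filter.1 hb).2
  choose! f hf using hone
  have hfB : ∀ e ∈ (A + -B) \ X, f e ∈ B ∧ f e + e ∈ A := by
    intro e he
    have : f e ∈ B.filter fun b => b + e ∈ A := by rw [hf e he]; exact mem_singleton_self _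
    exact mem_filter.1 this
  obtain ⟨e, he, e', he', hne, heq⟩ := exists_ne_map_eq_of_card_lt_of_maps_to hY
    (fun e he => (hfB e he).1)
  have hsum : ∀ e ∈ (A + -B) \ X, (A ∪ B.image (· + e)).image (· + f e) = A + B := by
    intro e he
    apply eq_of_subset_of_card_le
    · intro z hz
      obtain ⟨x, hx, rfl⟩ := mem_image.1 hz
      rcases mem_union.1 hx with hx | hx
      · exact add_mem_add hx (hfB e he).1
      · obtain ⟨b, hb, rfl⟩ := mem_image.1 hx
        have := add_mem_add (hfB e he).2 hb
        rwa [show f e + e + b = b + e + f e by ring] at this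
    · rw [card_image_of_injective _ (add_left_injective _)]
      have h1 := card_union_add_card_inter A (B.image (· + e))
      rw [card_image_of_injective _ (add_left_injective _)] at h1
      have h2 : A ∩ B.image (· + e) ⊆ {f e + e} := by
        intro x hx
        obtain ⟨hxA, hxB⟩ := mem_inter.1 hx
        obtain ⟨b, hb, rfl⟩ := mem_image.1 hxB
        have : b ∈ B.filter fun b => b + e ∈ A := mem_filter.2 ⟨hb, hxA⟩
        rw [hf e he, mem_singleton] at this
        simp [this]
      have h3 := card_le_card h2
      rw [card_singleton] at h3
      omega
  have hsd : ∀ e ∈ (A + -B) \ X, (A ∪ B.image (· + e)) \ A = (B.erase (f e)).image (· + e) := by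
    intro e he
    ext x
    simp only [mem_sdiff, mem_union, mem_image, mem_erase]
    constructor
    · rintro ⟨hx | ⟨b, hb, rfl⟩, hxA⟩
      · exact absurd hx hxA
      · exact ⟨b, ⟨fun h => hxA (h ▸ (hfB e he).2), hb⟩, rfl⟩
    · rintro ⟨b, ⟨hb, hbB⟩, rfl⟩
      refine ⟨Or.inr ⟨b, hbB, rfl⟩, fun hA' => hb ?_⟩
      have : b ∈ B.filter fun b => b + e ∈ A := mem_filter.2 ⟨hbB, hA'⟩
      rwa [hf e he, mem_singleton] at this
  have hu : A ∪ B.image (· + e) = A ∪ B.image (· + e') := by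
    have := (hsum e he).trans (hsum e' he').symm
    rw [heq] at this
    exact image_injective (add_left_injective _) this
  have himg : (B.erase (f e)).image (· + e) = (B.erase (f e)).image (· + e') := by
    rw [← hsd e he, hu, hsd e' he', heq]
  have hc := card_erase_of_mem (hfB e he).1
  exact hne (eq_of_image_add_eq (card_pos.1 (by omega)) (by omega) himg)

/-- **Vosper's theorem.** -/
theorem vosper {A B : Finset (ZMod p)} (hA : 2 ≤ A.card) (hB : 2 ≤ B.card)
    (hAB : (A + B).card + 1 ≤ A.card + B.card) (hp : (A + B).card + 2 ≤ p) :
    ∃ d : ZMod p, d ≠ 0 ∧ IsProgressionWithStep d A ∧ IsProgressionWithStep d B := by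
  suffices H : ∀ m : ℕ, ∀ A B : Finset (ZMod p), B.card = m → 2 ≤ A.card → 2 ≤ B.card →
      (A + B).card + 1 ≤ A.card + B.card → (A + B).card + 2 ≤ p →
      ∃ d : ZMod p, d ≠ 0 ∧ IsProgressionWithStep d A ∧ IsProgressionWithStep d B from
    H _ A B rfl hA hB hAB hp
  clear hA hB hAB hp A B
  intro m
  induction m using Nat.strong_induction_on with
  | _ m ih =>
  intro A B hm hA hB hAB hp
  have hAne : A.Nonempty := card_pos.1 (by omega)
  have hBne : B.Nonempty := card_pos.1 (by omega)
  rcases hB.eq_or_lt with hB2 | hB3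
  · obtain ⟨x, y, hxy, rfl⟩ := card_eq_two.1 hB2.symm
    have hprog : IsProgressionWithStep (y - x) ({x, y} : Finset (ZMod p)) := by
      refine (card_le_card (t := {y}) ?_).trans_eq (card_singleton y)
      intro z hz
      simp only [mem_filter, mem_insert, mem_singleton] at hz ⊢
      rcases hz with ⟨rfl | rfl, hz⟩
      · exact absurd (Or.inr (by ring)) hz
      · rfl
    exact ⟨y - x, sub_ne_zero.2 hxy.symm, .of_add hAne hB hprog hAB (by omega), hprog⟩
  -- The Dyson transform along `e` keeps the total size and, by Cauchy–Davenport, the sumset, while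
  -- it shrinks `B` to a set still having two elements.
  obtain ⟨e, he2, helt⟩ := exists_translate_inter_card hA hB3 hAB hp
  set B' := B.filter fun b => b + e ∈ A with hB'
  set A' := A ∪ B.image (· + e) with hA'
  have hcard : A'.card + B'.card = A.card + B.card := by
    have h1 := card_union_add_card_inter A (B.image (· + e))
    rw [card_image_of_injective _ (add_left_injective _)] at h1
    rw [← h1, hA']
    congr 1
    rw [← card_image_of_injective B' (add_left_injective e)]
    congr 1
    ext x
    simp only [hB', mem_image, mem_filter, mem_inter]
    exact ⟨by rintro ⟨b, ⟨h1, h2⟩, rfl⟩; exact ⟨h2, b, h1, rfl⟩,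
      by rintro ⟨h2, b, h1, rfl⟩; exact ⟨b, ⟨h1, h2⟩, rfl⟩⟩
  have hsub : A' + B' ⊆ A + B := by
    intro z hz
    obtain ⟨x, hx, b, hb, rfl⟩ := mem_add.1 hz
    obtain ⟨hb1, hb2⟩ := mem_filter.1 hb
    rcases mem_union.1 hx with hx | hx
    · exact add_mem_add hx hb1
    · obtain ⟨b', hb', rfl⟩ := mem_image.1 hx
      have := add_mem_add hb2 hb'
      rwa [show b + e + b' = b' + e + b by ring] at this
  have hA'2 : 2 ≤ A'.card := hA.trans (card_le_card subset_union_left)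
  have hB'ne : B'.Nonempty := card_pos.1 (by omega)
  have hA'ne : A'.Nonempty := card_pos.1 (by omega)
  have hle := card_le_card hsub
  have heq : A' + B' = A + B := by
    refine eq_of_subset_of_card_le hsub ?_
    rcases min_le_iff.1 (ZMod.cauchy_davenport (Fact.out : p.Prime) hA'ne hB'ne) with h | h <;>
      omega
  obtain ⟨d, hd, hdA, hdB⟩ := ih _ (hm ▸ helt) A' B' rfl hA'2 he2 (by omega) (by omega)
  have hDcard : 2 ≤ ((A + B)ᶜ).card := by
    rw [card_compl, ZMod.card]
    omega
  have hDne : ((A + B)ᶜ).Nonempty := card_pos.1 (by omega)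
  -- The progression property passes from `A'` to the common complement `(A + B)ᶜ` by duality, and
  -- from there back to the original `A` and `B`.
  have hD : IsProgressionWithStep d (A + B)ᶜ := by
    have h := card_compl_add_neg (A := A') (B := B') hB'ne (by omega) (by omega)
    rw [heq] at h
    exact .of_add hDne (by rwa [card_neg]) hdA.neg h.1 h.2
  have key : ∀ A B : Finset (ZMod p), A.Nonempty → B.Nonempty →
      (A + B).card + 1 ≤ A.card + B.card → (A + B).card ≤ p → 2 ≤ ((A + B)ᶜ).card →
      IsProgressionWithStep d (A + B)ᶜ → IsProgressionWithStep d A := by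
    intro A B hA hB h1 h2 h3 h4
    have h := card_compl_add_neg hB h1 h2
    rw [add_comm ((A + B)ᶜ), add_comm ((A + B)ᶜ.card)] at h
    have := (IsProgressionWithStep.of_add hA.neg h3 h4 h.1 h.2).neg
    rwa [neg_neg] at this
  refine ⟨d, hd, key A B hAne hBne hAB (by omega) hDcard hD, ?_⟩
  rw [add_comm A B] at hD hDcard hAB hp
  exact key B A hBne hAne (by omega) (by omega) hDcard hD

end Vosper

/-! ### Largest sum-free sets in `ZMod p` -/

section SumFreeZMod

variable {p : ℕ} [Fact p.Prime]

/-- `A` is an interval of length `k + 1` with right endpoint `y`. Symmetry exchanges its ends, so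
`2y = k = 2(2k + 1)` modulo `p`, whence `y = 2k + 1`. -/
theorem mem_middleResidues_of_step_one {k : ℕ} (hk : p = 3 * k + 2) (hk0 : 0 < k)
    {A : Finset (ZMod p)} (hcard : A.card = k + 1) (hneg : ∀ x ∈ A, -x ∈ A)
    (h : IsProgressionWithStep 1 A) : A ⊆ middleResidues p k := by
  obtain ⟨y, hyA, hy⟩ : ∃ y ∈ A, y + 1 ∉ A := by
    by_contra! hcon
    obtain ⟨x, hx⟩ : A.Nonempty := card_pos.1 (by omega)
    have hall : ∀ n : ℕ, x + n ∈ A := by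
      intro n
      induction n with
      | zero => simpa using hx
      | succ n ih => simpa [add_assoc] using hcon _ ih
    have : A = univ := by
      refine eq_univ_iff_forall.2 fun z => ?_
      have := hall (z - x).val
      rwa [ZMod.natCast_zmod_val, add_sub_cancel] at this
    rw [this, card_univ, ZMod.card] at hcard
    omega
  have huniq : ∀ z ∈ A, z + 1 ∉ A → z = y := fun z hz hz' =>
    card_le_one.1 h z (mem_filter.2 ⟨hz, hz'⟩) y (mem_filter.2 ⟨hyA, hy⟩)
  have hstep : ∀ i : ℕ, i + 1 < p → y - (i + 1 : ℕ) ∈ A → y - (i : ℕ) ∈ A := by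
    intro i hi hiA
    by_contra hcon
    have := huniq _ hiA (by
      rwa [show y - ((i + 1 : ℕ) : ZMod p) + 1 = y - (i : ℕ) by push_cast; ring])
    have h0 : ((i + 1 : ℕ) : ZMod p) = 0 := by simpa using this
    rw [ZMod.natCast_eq_zero_iff] at h0
    exact absurd (Nat.le_of_dvd (by omega) h0) (by omega)
  have hdown : ∀ i : ℕ, i < p → y - (i : ℕ) ∈ A → ∀ j ≤ i, y - (j : ℕ) ∈ A := by
    intro i
    induction i with
    | zero => intro _ h j hj; obtain rfl : j = 0 := by omega
              exact h
    | succ i ih =>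
      intro hi hiA j hj
      rcases hj.eq_or_lt with rfl | hj
      · exact hiA
      · exact ih (by omega) (hstep i hi hiA) j (by omega)
  set I := (range p).filter fun i : ℕ => y - (i : ZMod p) ∈ A with hI
  have hIcard : I.card = k + 1 := by
    rw [← hcard]
    refine card_bij' (fun i _ => y - (i : ZMod p)) (fun x _ => (y - x).val) ?_ ?_ ?_ ?_
    · intro i hi
      exact (mem_filter.1 hi).2
    · intro x hx
      refine mem_filter.2 ⟨mem_range.2 (ZMod.val_lt _), ?_⟩
      rwa [ZMod.natCast_zmod_val, sub_sub_cancel]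
    · intro i hi
      rw [sub_sub_cancel, ZMod.val_natCast_of_lt (mem_range.1 (mem_filter.1 hi).1)]
    · intro x hx
      simp only [ZMod.natCast_zmod_val, sub_sub_cancel]
  have hIle : ∀ i ∈ I, i ≤ k := by
    intro i hi
    by_contra hcon
    have : range (k + 2) ⊆ I := by
      intro j hj
      rw [mem_range] at hj
      obtain ⟨h1, h2⟩ := mem_filter.1 hi
      rw [mem_range] at h1
      exact mem_filter.2 ⟨mem_range.2 (by omega), hdown i h1 h2 j (by omega)⟩
    have := card_le_card this
    rw [card_range] at this
    omega
  have hIeq : I = range (k + 1) := by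
    refine eq_of_subset_of_card_le (fun i hi => mem_range.2 (Nat.lt_succ_of_le (hIle i hi))) ?_
    rw [card_range, hIcard]
  have hkI : y - (k : ℕ) ∈ A := (mem_filter.1 (hIeq ▸ mem_range.2 (Nat.lt_succ_self k) : k ∈ I)).2
  have hkI' : y - ((k + 1 : ℕ) : ZMod p) ∉ A := by
    intro hcon
    have : k + 1 ∈ I := mem_filter.2 ⟨mem_range.2 (by omega), hcon⟩
    exact absurd (hIle _ this) (by omega)
  have hy2 : 2 * y = k := by
    have h1 := hneg _ hkI
    have h2 := huniq _ h1 (fun hcon => hkI' (by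
      have := hneg _ hcon
      rwa [show -(-(y - (k : ZMod p)) + 1) = y - ((k + 1 : ℕ) : ZMod p) by push_cast; ring] at this))
    linear_combination -h2
  have hp0 : (3 * k + 2 : ZMod p) = 0 := by
    have : ((3 * k + 2 : ℕ) : ZMod p) = 0 :=
      (ZMod.natCast_eq_zero_iff _ _).2 (Dvd.intro 1 (by omega))
    exact_mod_cast this
  have hyk : y = 2 * k + 1 := by
    have h2 : (2 : ZMod p) ≠ 0 := by
      have : ((2 : ℕ) : ZMod p) ≠ 0 := by
        rw [Ne, ZMod.natCast_eq_zero_iff]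
        exact fun hd => absurd (Nat.le_of_dvd (by norm_num) hd) (by omega)
      exact_mod_cast this
    apply mul_left_cancel₀ h2
    linear_combination hy2 - hp0
  intro x hx
  have hxI : (y - x).val ∈ I := mem_filter.2 ⟨mem_range.2 (ZMod.val_lt _), by
    rwa [ZMod.natCast_zmod_val, sub_sub_cancel]⟩
  have hle := hIle _ hxI
  refine mem_image.2 ⟨2 * k + 1 - (y - x).val, mem_Icc.2 ⟨by omega, by omega⟩, ?_⟩
  rw [Nat.cast_sub (by omega), ZMod.natCast_zmod_val, hyk]
  push_cast
  ring

/-- A sum-free subset of `ℤ/pℤ` of the largest size is a dilate of the middle residues. -/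
theorem exists_mul_mem_middleResidues {k : ℕ} (hk : p = 3 * k + 2) {A : Finset (ZMod p)}
    (hA : IsSumFree A) (hcard : A.card = k + 1) :
    ∃ u : ZMod p, ∀ x ∈ A, u * x ∈ middleResidues p k := by
  have hprime : p.Prime := Fact.out
  rcases Nat.eq_zero_or_pos k with rfl | hk0
  · obtain ⟨a, rfl⟩ := card_eq_one.1 hcard
    have ha : a ≠ 0 := by
      rintro rfl
      exact hA 0 (by simp) 0 (by simp) (by simp)
    refine ⟨a⁻¹, fun x hx => ?_⟩
    rw [mem_singleton.1 hx, inv_mul_cancel₀ ha]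
    simp [middleResidues]
  have hAne : A.Nonempty := card_pos.1 (by omega)
  have hcompl : Aᶜ.card = 2 * k + 1 := by
    rw [card_compl, ZMod.card, hcard]
    omega
  have hadd : A + A ⊆ Aᶜ := by
    intro z hz
    obtain ⟨x, hx, y, hy, rfl⟩ := mem_add.1 hz
    exact mem_compl.2 (hA x hx y hy)
  have hsub : A + -A ⊆ Aᶜ := by
    intro z hz
    obtain ⟨x, hx, y, hy, rfl⟩ := mem_add.1 hz
    rw [mem_compl]
    intro hz
    apply hA _ hz _ (mem_neg'.1 hy)
    simpa using hx
  -- Cauchy–Davenport gives `A - A` at least `2k + 1` elements, which is all of `Aᶜ`. Thus `Aᶜ` is a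
  -- difference set, and `A` is symmetric.
  have hsubeq : A + -A = Aᶜ := by
    refine eq_of_subset_of_card_le hsub ?_
    have := ZMod.cauchy_davenport hprime hAne hAne.neg
    rw [card_neg] at this
    rcases min_le_iff.1 this with h | h <;> omega
  have hneg : ∀ x ∈ A, -x ∈ A := by
    intro x hx
    by_contra hcon
    rw [← mem_compl, ← hsubeq] at hcon
    obtain ⟨y, hy, z, hz, hyz⟩ := mem_add.1 hcon
    have : x ∈ A + -A := mem_add.2 ⟨-z, mem_neg'.1 hz, -y, by simpa using hy, by
      rw [← neg_neg x, ← hyz]; ring⟩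
    rw [hsubeq, mem_compl] at this
    exact this hx
  have haddcard := card_le_card hadd
  obtain ⟨d, hd, hdA, -⟩ := vosper (A := A) (B := A) (by omega) (by omega) (by omega) (by omega)
  have hinj : Function.Injective fun x : ZMod p => d⁻¹ * x :=
    mul_right_injective₀ (inv_ne_zero hd)
  have hmem : ∀ x, x ∈ A.image (fun x => d⁻¹ * x) ↔ d * x ∈ A := by
    intro x
    rw [mem_image]
    refine ⟨?_, fun h => ⟨d * x, h, by rw [inv_mul_cancel_left₀ hd]⟩⟩
    rintro ⟨y, hy, rfl⟩
    rwa [mul_inv_cancel_left₀ hd]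
  have := mem_middleResidues_of_step_one hk hk0 (A := A.image fun x => d⁻¹ * x)
    (by rw [card_image_of_injective _ hinj, hcard])
    (fun x hx => by
      rw [hmem] at hx ⊢
      rw [mul_neg]
      exact hneg _ hx) (by
      unfold IsProgressionWithStep at hdA ⊢
      refine le_trans (le_of_eq ?_) hdA
      refine card_bij' (fun x _ => d * x) (fun x _ => d⁻¹ * x) ?_ ?_ ?_ ?_
      · intro x hx
        simpa only [mem_filter, hmem, mul_add, mul_one] using hx
      · intro x hx
        simpa only [mem_filter, hmem, mul_add, mul_one, mul_inv_cancel_left₀ hd] using hx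
      · intro x hx
        exact inv_mul_cancel_left₀ hd x
      · intro x hx
        exact mul_inv_cancel_left₀ hd x)
  exact ⟨d⁻¹, fun x hx => this (mem_image_of_mem _ hx)⟩

end SumFreeZMod

/-! ### Structure of dense sum-free sets in abelian groups -/

section Stability

open Classical

variable {G : Type*} [AddCommGroup G] [Fintype G]

theorem card_filter_hom_mem {H : Type*} [AddCommGroup H] [Fintype H] (f : G →+ H)
    (hf : Function.Surjective f) (T : Finset H) :
    (univ.filter fun x => f x ∈ T).card * Fintype.card H = T.card * Fintype.card G := by
  have key : ∀ T : Finset H, (univ.filter fun x => f x ∈ T).card =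
      T.card * (univ.filter fun x => f x = 0).card := by
    intro T
    rw [card_eq_sum_card_fiberwise (f := f) (t := T) (fun x hx => by simpa using hx),
      ← smul_eq_mul, ← sum_const]
    refine sum_congr rfl fun y hy => ?_
    rw [filter_filter, ← AddMonoidHom.card_fiber_eq_of_mem_range f (hf y) (hf 0)]
    congr 1
    ext x
    simp only [mem_filter, mem_univ, true_and, and_iff_right_iff_imp]
    rintro rfl
    exact hy
  have h1 := key T
  have h2 := key univ
  simp only [mem_univ, filter_true, card_univ] at h2
  rw [h1, h2]
  ring

theorem exists_prime_factor_two_mod_three : ∀ m : ℕ, m % 3 = 2 →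
    ∃ q, q.Prime ∧ q % 3 = 2 ∧ q ∣ m := by
  intro m
  induction m using Nat.strong_induction_on with
  | _ m ih =>
  intro hm
  have hm1 : m ≠ 1 := by omega
  have hq := Nat.minFac_prime hm1
  obtain ⟨r, hr⟩ := Nat.minFac_dvd m
  have hmod : m % 3 = (m.minFac % 3) * (r % 3) % 3 := by
    conv_lhs => rw [hr, Nat.mul_mod]
  have hq2 := hq.two_le
  have h3 : m.minFac % 3 < 3 := Nat.mod_lt _ (by norm_num)
  interval_cases h : m.minFac % 3
  · omega
  · have hlt : r < m := by
      have : 0 < r := Nat.pos_of_ne_zero (by rintro rfl; omega)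
      nlinarith
    obtain ⟨q, h1, h2, h3⟩ := ih r hlt (by omega)
    exact ⟨q, h1, h2, h3.trans (Dvd.intro_left _ hr.symm)⟩
  · exact ⟨_, hq, h, Nat.minFac_dvd m⟩

/-- A sum-free set of density more than `1/3` is contained in the preimage of a sum-free set of
size `(m + 1) / 3` in a quotient of order `m`. -/
theorem IsSumFree.exists_subgroup {A : Finset G} (hA : IsSumFree A)
    (hcard : Fintype.card G < 3 * A.card) :
    ∃ K : AddSubgroup G, (∀ x ∈ A, ∀ y ∈ A, ∀ z ∈ A, x + y - z ∉ K) ∧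
      3 * (A.image (QuotientAddGroup.mk : G → G ⧸ K)).card = Nat.card (G ⧸ K) + 1 ∧
      A.card * Nat.card (G ⧸ K) ≤
        (A.image (QuotientAddGroup.mk : G → G ⧸ K)).card * Fintype.card G := by
  have hAne : A.Nonempty := card_pos.1 (by omega)
  -- As `A + A` is `K`-periodic, it misses the whole hull of `A`. Kneser then gives `3 |A + K| ≤ n +
  -- |K|`, that is `3t ≤ m + 1` in the quotient, while density above `1/3` gives `3t > m`.
  obtain ⟨K, hper, hK⟩ := strongKneserBound hAne hAne
  have hsf : ∀ x ∈ A, ∀ y ∈ A, ∀ z ∈ A, x + y - z ∉ K := by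
    intro x hx y hy z hz hcon
    have h1 := hper (x + y) (add_mem_add hx hy) _ (K.neg_mem hcon)
    rw [show x + y + -(x + y - z) = z by abel] at h1
    obtain ⟨u, hu, v, hv, rfl⟩ := mem_add.1 h1
    exact hA u hu v hv hz
  have hdisj : Disjoint (A + A) (cosetHull K A) := by
    rw [Finset.disjoint_left]
    intro y hy hy'
    obtain ⟨u, hu, v, hv, rfl⟩ := mem_add.1 hy
    obtain ⟨z, hz, hyz⟩ := mem_cosetHull.1 hy'
    exact hsf u hu v hv z hz hyz
  have hle := card_le_univ (A + A ∪ cosetHull K A)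
  rw [card_union_of_disjoint hdisj] at hle
  have hhull : cosetHull K A = univ.filter fun x =>
      QuotientAddGroup.mk' K x ∈ A.image (QuotientAddGroup.mk : G → G ⧸ K) := by
    ext x
    simp only [mem_cosetHull, mem_filter, mem_univ, true_and, mem_image,
      QuotientAddGroup.mk'_apply, QuotientAddGroup.eq]
    refine exists_congr fun a => and_congr_right fun _ => ?_
    rw [sub_eq_neg_add]
  have hc : (cosetHull K A).card * Fintype.card (G ⧸ K) =
      (A.image (QuotientAddGroup.mk : G → G ⧸ K)).card * Fintype.card G := by
    rw [hhull]
    convert card_filter_hom_mem (QuotientAddGroup.mk' K) (QuotientAddGroup.mk'_surjective K)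
      (A.image (QuotientAddGroup.mk : G → G ⧸ K))
  have hn : Fintype.card G = Nat.card (G ⧸ K) * Nat.card K := by
    rw [← Nat.card_eq_fintype_card]
    exact AddSubgroup.card_eq_card_quotient_mul_card_addSubgroup K
  rw [← Nat.card_eq_fintype_card (α := G ⧸ K)] at hc
  have hsub := card_le_card (subset_cosetHull K A)
  set m := Nat.card (G ⧸ K)
  set t := (A.image (QuotientAddGroup.mk : G → G ⧸ K)).card
  set n := Fintype.card G
  set h := (cosetHull K A).card
  have hnpos : 0 < n := Fintype.card_pos
  have hmpos : 0 < m := Nat.pos_of_ne_zero fun h0 => by rw [h0, zero_mul] at hn; omega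
  refine ⟨K, hsf, ?_, ?_⟩
  · apply le_antisymm
    · refine le_of_mul_le_mul_right ?_ hnpos
      have : 3 * h ≤ n + Nat.card K := by omega
      calc 3 * t * n = 3 * h * m := by rw [mul_assoc, ← hc]; ring
        _ ≤ (n + Nat.card K) * m := Nat.mul_le_mul_right _ this
        _ = (m + 1) * n := by rw [add_mul, add_mul, one_mul, mul_comm (Nat.card K), ← hn]; ring
    · refine Nat.succ_le_of_lt (lt_of_mul_lt_mul_right ?_ (Nat.zero_le n))
      calc m * n < m * (3 * h) := Nat.mul_lt_mul_of_pos_left (by omega) hmpos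
        _ = 3 * t * n := by rw [mul_assoc, ← hc]; ring
  · rw [← hc]
    exact Nat.mul_le_mul_right _ hsub

variable {p k : ℕ}

theorem IsTypeI.le_of_mod_three (hG : IsTypeI p G) (K : AddSubgroup G)
    (hK : Nat.card (G ⧸ K) % 3 = 2) : p ≤ Nat.card (G ⧸ K) := by
  obtain ⟨q, hq, hq3, hqd⟩ := exists_prime_factor_two_mod_three _ hK
  have hd : Nat.card (G ⧸ K) ∣ Fintype.card G := by
    rw [← Nat.card_eq_fintype_card]
    exact AddSubgroup.card_quotient_dvd_card K
  exact (hG.2 ⟨hq, hq3, hqd.trans hd⟩).trans (Nat.le_of_dvd Nat.card_pos hqd)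

/-- Above density `1/3`, the density is at most `(m + 1) / (3m)` for a quotient of order `m ≡ 2 (mod
3)`. This decreases in `m`, and `m ≥ p`. -/
theorem IsSumFree.card_mul_le (hk : p = 3 * k + 2) (hG : IsTypeI p G) {A : Finset G}
    (hA : IsSumFree A) : A.card * p ≤ (k + 1) * Fintype.card G := by
  rcases le_or_gt (3 * A.card) (Fintype.card G) with h | h
  · nlinarith
  obtain ⟨K, -, h1, h2⟩ := hA.exists_subgroup h
  have hp := hG.le_of_mod_three K (by omega)
  set m := Nat.card (G ⧸ K)
  set t := (A.image (QuotientAddGroup.mk : G → G ⧸ K)).card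
  have hm : 0 < m := by omega
  refine le_of_mul_le_mul_right (a := 3 * m) ?_ (by omega)
  calc A.card * p * (3 * m) = A.card * m * (3 * p) := by ring
    _ ≤ t * Fintype.card G * (3 * p) := Nat.mul_le_mul_right _ h2
    _ = Fintype.card G * ((m + 1) * p) := by rw [← h1]; ring
    _ ≤ Fintype.card G * (m * (p + 1)) := Nat.mul_le_mul_left _ (by nlinarith)
    _ = (k + 1) * Fintype.card G * (3 * m) := by rw [hk]; ring

/-- The density threshold `(p + 2) / (3 (p + 1))` is the value of `(m + 1) / (3m)` at `m = p + 1`,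
so exceeding it forces the quotient to have order exactly `p`. -/
theorem IsSumFree.exists_hom (hp : p.Prime) (hk : p = 3 * k + 2) (hG : IsTypeI p G)
    {A : Finset G} (hA : IsSumFree A) (hcard : (p + 2) * Fintype.card G < 3 * (p + 1) * A.card) :
    ∃ ψ : G →+ ZMod p, ∀ x ∈ A, ψ x ∈ middleResidues p k := by
  have : Fact p.Prime := ⟨hp⟩
  have hn : 0 < Fintype.card G := Fintype.card_pos
  obtain ⟨K, h0, h1, h2⟩ := hA.exists_subgroup (by
    by_contra hcon
    push Not at hcon
    nlinarith)
  have hpm := hG.le_of_mod_three K (by omega)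
  have hmp : Nat.card (G ⧸ K) = p := by
    refine le_antisymm ?_ hpm
    set m := Nat.card (G ⧸ K)
    set t := (A.image (QuotientAddGroup.mk : G → G ⧸ K)).card
    have hm : 0 < m := by have := hp.pos; omega
    have : (p + 2) * Fintype.card G * m < (m + 1) * (p + 1) * Fintype.card G :=
      calc (p + 2) * Fintype.card G * m < 3 * (p + 1) * A.card * m :=
            Nat.mul_lt_mul_of_pos_right hcard hm
        _ = 3 * (p + 1) * (A.card * m) := by ring
        _ ≤ 3 * (p + 1) * (t * Fintype.card G) := Nat.mul_le_mul_left _ h2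
        _ = (m + 1) * (p + 1) * Fintype.card G := by rw [← h1]; ring
    have : (p + 2) * m < (m + 1) * (p + 1) := by
      refine lt_of_mul_lt_mul_right (a := Fintype.card G) ?_ (Nat.zero_le _)
      linarith
    nlinarith
  have : IsAddCyclic (G ⧸ K) := isAddCyclic_of_prime_card hmp
  let e : G ⧸ K ≃+ ZMod p := ((ZMod.ringEquivCongr hmp).symm.toAddEquiv.trans
    (zmodAddCyclicAddEquiv inferInstance)).symm
  let f : G →+ ZMod p := e.toAddMonoidHom.comp (QuotientAddGroup.mk' K)
  have hf : ∀ x, f x = 0 ↔ x ∈ K := by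
    intro x
    simp [f]
  have hsf : IsSumFree (A.image f) := by
    intro x hx y hy hxy
    obtain ⟨a, ha, rfl⟩ := mem_image.1 hx
    obtain ⟨b, hb, rfl⟩ := mem_image.1 hy
    obtain ⟨c, hc, habc⟩ := mem_image.1 hxy
    apply h0 a ha b hb c hc
    rw [← hf, map_sub, map_add, habc, sub_self]
  have hcardf : (A.image f).card = k + 1 := by
    have : A.image f = (A.image (QuotientAddGroup.mk : G → G ⧸ K)).image e := by
      rw [image_image]
      rfl
    rw [this, card_image_of_injective _ e.injective]
    omega
  obtain ⟨u, hu⟩ := exists_mul_mem_middleResidues hk (by convert hsf) (by convert hcardf)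
  exact ⟨(AddMonoidHom.mulLeft u).comp f, fun x hx => hu _ (by convert mem_image_of_mem f hx)⟩

end Stability

/-! ### Removal lemma for `x + y = z` from triangle removal -/

section Removal

open Classical

universe u

/-- The pairs in `F` whose sum is in `F`. -/
noncomputable def schurPairs {G : Type*} [Add G] (F : Finset G) : Finset (G × G) :=
  (F ×ˢ F).filter fun x => x.1 + x.2 ∈ F

theorem mem_schurPairs {G : Type*} [Add G] {F : Finset G} {x : G × G} :
    x ∈ schurPairs F ↔ (x.1 ∈ F ∧ x.2 ∈ F) ∧ x.1 + x.2 ∈ F := by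
  simp [schurPairs]

variable {G : Type*} [AddCommGroup G] [Fintype G]

/-- The triangles of the tripartite graph attached to a family of pairs. -/
noncomputable def schurTriangles (T : Finset (G × G)) : Finset (G × G × G) :=
  (univ ×ˢ T).image fun x : G × G × G => (x.1, x.1 + x.2.1, x.1 + x.2.1 + x.2.2)

theorem mem_schurTriangles {T : Finset (G × G)} {a b c : G} :
    (a, b, c) ∈ schurTriangles T ↔ (b - a, c - b) ∈ T := by
  simp only [schurTriangles, mem_image, mem_product, mem_univ, true_and, Prod.exists,
    Prod.mk.injEq]
  constructor
  · rintro ⟨g, x, y, h, rfl, rfl, rfl⟩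
    simpa using h
  · intro h
    exact ⟨a, b - a, c - b, h, rfl, by abel, by abel⟩

theorem card_schurTriangles (T : Finset (G × G)) :
    (schurTriangles T).card = Fintype.card G * T.card := by
  rw [schurTriangles, card_image_of_injective, card_product, card_univ]
  rintro ⟨a, b, c⟩ ⟨a', b', c'⟩ h
  simp only [Prod.mk.injEq] at h ⊢
  obtain ⟨rfl, h1, h2⟩ := h
  have h1 := add_left_cancel h1
  subst h1
  exact ⟨rfl, rfl, add_left_cancel h2⟩

-- The three edges of a triangle may come from different members of `T`, but their differences `b -
-- a`, `c - b`, `c - a` all lie in `F`. So every triangle is a Schur pair together with a base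
-- point.
open SimpleGraph TripartiteFromTriangles in
theorem card_cliqueFinset_schurTriangles_le {F : Finset G} {T : Finset (G × G)}
    (hT : T ⊆ schurPairs F) :
    ((graph (schurTriangles T)).cliqueFinset 3).card ≤
      Fintype.card G * (schurPairs F).card := by
  have hsub : (graph (schurTriangles T)).cliqueFinset 3 ⊆
      (schurTriangles (schurPairs F)).map toTriangle := by
    intro s hs
    rw [mem_cliqueFinset_iff, SimpleGraph.is3Clique_iff] at hs
    obtain ⟨x, y, z, hxy, hxz, hyz, rfl⟩ := hs
    obtain ⟨a, b, c, habc, h01, h02, h12⟩ := graph_triple hxy hxz hyz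
    rw [mem_map]
    refine ⟨(a, b, c), ?_, by simpa using habc⟩
    rw [Graph.in₀₁_iff] at h01
    rw [Graph.in₀₂_iff] at h02
    rw [Graph.in₁₂_iff] at h12
    obtain ⟨c', h01⟩ := h01
    obtain ⟨b', h02⟩ := h02
    obtain ⟨a', h12⟩ := h12
    rw [mem_schurTriangles] at h01 h02 h12 ⊢
    have h1 := mem_schurPairs.1 (hT h01)
    have h2 := mem_schurPairs.1 (hT h02)
    have h3 := mem_schurPairs.1 (hT h12)
    refine mem_schurPairs.2 ⟨⟨h1.1.1, h3.1.2⟩, ?_⟩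
    have := h2.2
    simp only at this ⊢
    rwa [show b - a + (c - b) = b' - a + (c - b') by abel]
  refine (card_le_card hsub).trans_eq ?_
  rw [card_map, card_schurTriangles]

-- The three injectivity conditions say that the triangles built from `T` are edge-disjoint, so the
-- graph is far from triangle-free. In `ε / 27` the denominator is `3 · 3²`, from the bound on `3
-- |T|` and the square of the `3n` vertices; the leading `27` is `3³`.
open SimpleGraph TripartiteFromTriangles in
theorem le_card_schurPairs {F : Finset G} {T : Finset (G × G)} (hT : T ⊆ schurPairs F)
    (h₁ : Set.InjOn Prod.fst (T : Set (G × G))) (h₂ : Set.InjOn Prod.snd (T : Set (G × G)))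
    (h₃ : Set.InjOn (fun x : G × G => x.1 + x.2) (T : Set (G × G))) {ε : ℝ}
    (hε : ε * Fintype.card G ≤ 3 * T.card) :
    27 * triangleRemovalBound (ε / 27) * (Fintype.card G : ℝ) ^ 2 ≤ (schurPairs F).card := by
  have : ExplicitDisjoint (schurTriangles T) := by
    constructor
    · intro a b c a' h h'
      rw [mem_schurTriangles] at h h'
      have := h₂ h h' rfl
      simpa using this
    · intro a b c b' h h'
      rw [mem_schurTriangles] at h h'
      have := h₃ h h' (by simp)
      simp only [Prod.mk.injEq] at this
      exact sub_left_injective this.1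
    · intro a b c c' h h'
      rw [mem_schurTriangles] at h h'
      have := h₁ h h' rfl
      simpa using this
  have hn : (0 : ℝ) < Fintype.card G := by exact_mod_cast Fintype.card_pos
  have hfar : (graph (schurTriangles T)).FarFromTriangleFree (ε / 27) := by
    refine farFromTriangleFree _ ?_
    rw [card_schurTriangles]
    push_cast
    nlinarith
  have h1 := hfar.le_card_cliqueFinset
  have h2 : (((graph (schurTriangles T)).cliqueFinset 3).card : ℝ) ≤
      Fintype.card G * (schurPairs F).card := by
    exact_mod_cast card_cliqueFinset_schurTriangles_le hT
  refine le_of_mul_le_mul_left ?_ hn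
  refine le_trans (le_of_eq ?_) (h1.trans ?_)
  · simp only [Fintype.card_sum]
    push_cast
    ring
  · convert h2

/-- The **removal lemma** for the equation `x + y = z`. -/
theorem exists_sumFree_subset_of_card_schurPairs_lt (ε : ℝ) (hε : 0 < ε) :
    ∃ δ : ℝ, 0 < δ ∧ ∀ (G : Type u) [AddCommGroup G] [Fintype G] (F : Finset G),
      ((schurPairs F).card : ℝ) < δ * (Fintype.card G : ℝ) ^ 2 →
      ∃ B ⊆ F, IsSumFree B ∧ ((F \ B).card : ℝ) ≤ ε * Fintype.card G := by
  refine ⟨27 * SimpleGraph.triangleRemovalBound (ε / 27),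
    mul_pos (by norm_num) (SimpleGraph.triangleRemovalBound_pos (by positivity)), ?_⟩
  intro G _ _ F hF
  -- For a maximal such family `T`, every Schur triple of `F` uses an element occurring in `T`, or
  -- it could be added. Deleting at most `3 |T|` elements therefore makes `F` sum-free.
  set 𝒯 := (schurPairs F).powerset.filter fun T : Finset (G × G) =>
    Set.InjOn Prod.fst (T : Set (G × G)) ∧ Set.InjOn Prod.snd (T : Set (G × G)) ∧
      Set.InjOn (fun x : G × G => x.1 + x.2) (T : Set (G × G)) with h𝒯
  have hne : 𝒯.Nonempty := ⟨∅, by simp [h𝒯]⟩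
  obtain ⟨T, hT, hmax⟩ := exists_max_image 𝒯 card hne
  obtain ⟨hTF, h1, h2, h3⟩ := mem_filter.1 hT
  rw [mem_powerset] at hTF
  have hsmall : 3 * (T.card : ℝ) < ε * Fintype.card G := by
    by_contra hcon
    exact absurd (le_card_schurPairs hTF h1 h2 h3 (not_lt.1 hcon)) (not_le.2 hF)
  set R := T.image Prod.fst ∪ T.image Prod.snd ∪ T.image (fun x : G × G => x.1 + x.2) with hR
  refine ⟨F \ R, sdiff_subset, ?_, ?_⟩
  · intro x hx y hy hxy
    rw [mem_sdiff] at hx hy hxy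
    have notR : ∀ z ∉ R, (∀ w ∈ T, w.1 ≠ z) ∧ (∀ w ∈ T, w.2 ≠ z) ∧ ∀ w ∈ T, w.1 + w.2 ≠ z := by
      intro z hz
      simp only [hR, mem_union, mem_image, not_or, not_exists, not_and] at hz
      exact ⟨hz.1.1, hz.1.2, hz.2⟩
    have hnot : (x, y) ∉ T := fun h => (notR x hx.2).1 _ h rfl
    have hins : insert (x, y) T ∈ 𝒯 := by
      have hnot' : (x, y) ∉ (T : Set (G × G)) := hnot
      refine mem_filter.2 ⟨mem_powerset.2 (insert_subset
        (mem_schurPairs.2 ⟨⟨hx.1, hy.1⟩, hxy.1⟩) hTF), ?_⟩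
      rw [coe_insert]
      refine ⟨(Set.injOn_insert hnot').2 ⟨h1, ?_⟩, (Set.injOn_insert hnot').2 ⟨h2, ?_⟩,
        (Set.injOn_insert hnot').2 ⟨h3, ?_⟩⟩
      · rintro ⟨w, hw, hwx⟩
        exact (notR x hx.2).1 w hw hwx
      · rintro ⟨w, hw, hwx⟩
        exact (notR y hy.2).2.1 w hw hwx
      · rintro ⟨w, hw, hwx⟩
        exact (notR _ hxy.2).2.2 w hw hwx
    have := hmax _ hins
    rw [card_insert_of_notMem hnot] at this
    omega
  · have hle : (F \ (F \ R)).card ≤ 3 * T.card := by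
      calc (F \ (F \ R)).card ≤ R.card := by
            refine card_le_card ?_
            rw [sdiff_sdiff_right_self]
            exact inter_subset_right
        _ ≤ T.card + T.card + T.card := by
            refine (card_union_le _ _).trans (Nat.add_le_add ((card_union_le _ _).trans
              (Nat.add_le_add card_image_le card_image_le)) card_image_le)
        _ = 3 * T.card := by ring
    have : ((F \ (F \ R)).card : ℝ) ≤ 3 * T.card := by exact_mod_cast hle
    linarith

end Removal

/-! ### Containers for sum-free sets -/

section Containers

open Classical

universe u

/-- Few subsets of a finite type are small. -/
theorem exists_card_small_subsets_le (γ : ℝ) (hγ : 0 < γ) :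
    ∃ τ : ℝ, 0 < τ ∧ ∀ (V : Type u) [Fintype V],
      ((univ.filter fun U : Finset V => (U.card : ℝ) ≤ τ * Fintype.card V).card : ℝ) ≤
        (2 : ℝ) ^ (γ * Fintype.card V) := by
  -- Weight each set `U` by `x ^ |U|`. The total is `(1 + x) ^ n`, at most `2 ^ (γ n / 2)` by the
  -- choice of `x`; each small set weighs at least `2 ^ (-γ n / 2)` by the choice of `τ`.
  have h2 : (1 : ℝ) < 2 ^ (γ / 2) := Real.one_lt_rpow (by norm_num) (by positivity)
  set x : ℝ := min 1 (2 ^ (γ / 2) - 1) with hx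
  have hx0 : 0 < x := lt_min one_pos (by linarith)
  have hx1 : x ≤ 1 := min_le_left _ _
  have hx2 : x + 1 ≤ 2 ^ (γ / 2) := by
    have := min_le_right (1 : ℝ) (2 ^ (γ / 2) - 1)
    linarith
  have hlog : 0 ≤ -Real.log x := by
    have := Real.log_nonpos hx0.le hx1
    linarith
  set τ : ℝ := γ / 2 * Real.log 2 / (-Real.log x + 1) with hτ
  have hlog2 : 0 < Real.log 2 := Real.log_pos (by norm_num)
  refine ⟨τ, by positivity, fun V _ => ?_⟩
  set n : ℝ := ((Fintype.card V : ℕ) : ℝ) with hn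
  have hn0 : 0 ≤ n := Nat.cast_nonneg _
  have hτ' : τ * -Real.log x ≤ γ / 2 * Real.log 2 := by
    rw [hτ, div_mul_eq_mul_div, div_le_iff₀ (by linarith)]
    have : 0 ≤ γ / 2 * Real.log 2 := by positivity
    nlinarith
  have hpow : (1 : ℝ) ≤ 2 ^ (γ / 2 * n) * x ^ (τ * n) := by
    rw [Real.rpow_def_of_pos (by norm_num : (0 : ℝ) < 2), Real.rpow_def_of_pos hx0,
      ← Real.exp_add]
    apply Real.one_le_exp
    nlinarith
  set 𝒰 := univ.filter fun U : Finset V => (U.card : ℝ) ≤ τ * n with h𝒰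
  have hsum : ∑ U ∈ 𝒰, x ^ (τ * n) ≤ (x + 1) ^ Fintype.card V := by
    have h1 := sum_pow_mul_eq_add_pow x 1 (univ : Finset V)
    rw [card_univ] at h1
    rw [← h1, powerset_univ]
    refine (sum_le_sum (g := fun U => x ^ U.card * 1 ^ (Fintype.card V - U.card))
      fun U hU => ?_).trans (sum_le_sum_of_subset_of_nonneg (subset_univ _) fun U _ _ => by
        positivity)
    rw [one_pow, mul_one, ← Real.rpow_natCast]
    exact Real.rpow_le_rpow_of_exponent_ge hx0 hx1 (mem_filter.1 hU).2
  rw [sum_const, nsmul_eq_mul] at hsum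
  have hle : (x + 1) ^ Fintype.card V ≤ (2 : ℝ) ^ (γ / 2 * n) := by
    rw [Real.rpow_mul (by norm_num), hn, Real.rpow_natCast]
    exact pow_le_pow_left₀ (by linarith) hx2 _
  calc (𝒰.card : ℝ) ≤ 𝒰.card * (2 ^ (γ / 2 * n) * x ^ (τ * n)) :=
        le_mul_of_one_le_right (Nat.cast_nonneg _) hpow
    _ = 𝒰.card * x ^ (τ * n) * 2 ^ (γ / 2 * n) := by ring
    _ ≤ 2 ^ (γ / 2 * n) * 2 ^ (γ / 2 * n) :=
        mul_le_mul_of_nonneg_right (hsum.trans hle) (by positivity)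
    _ = 2 ^ (γ * n) := by
        rw [← Real.rpow_add (by norm_num)]
        ring_nf

/-- The **graph container lemma**: an independent set is determined up to a sparse set by a small
subset. -/
theorem exists_container_function {V : Type*} (r : V → V → Prop) (d : ℕ) (F : Finset V) :
    ∃ φ : Finset V → Finset V,
      (∀ S, φ S ⊆ F ∧ ∀ v ∈ φ S, ((φ S).filter (r v)).card < d) ∧
      ∀ A ⊆ F, (∀ x ∈ A, ∀ y ∈ A, ¬ r x y) →
        ∃ S ⊆ A, S.card * d ≤ F.card ∧ A ⊆ φ S ∪ S := by
  induction F using Finset.strongInduction with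
  | _ F ih =>
  -- Greedy step at a vertex `v` of high degree: if `v ∈ A`, record it in `S` and discard its at
  -- least `d` neighbours, otherwise discard `v` alone. The choice made is read off from whether `v
  -- ∈ S`, so `φ` needs only `S`.
  by_cases hF : ∃ v ∈ F, d ≤ (F.filter (r v)).card
  · obtain ⟨v, hv, hd⟩ := hF
    have hss : F.erase v ⊂ F := erase_ssubset hv
    obtain ⟨φ₀, h₀, h₀'⟩ := ih _ hss
    obtain ⟨φ₁, h₁, h₁'⟩ := ih (F.erase v \ F.filter (r v)) (sdiff_subset.trans_ssubset hss)
    refine ⟨fun S => if v ∈ S then φ₁ (S.erase v) else φ₀ S, fun S => ?_, fun A hA hind => ?_⟩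
    · by_cases hvS : v ∈ S
      · simp only [hvS, if_true]
        exact ⟨(h₁ _).1.trans (sdiff_subset.trans hss.subset), (h₁ _).2⟩
      · simp only [hvS, if_false]
        exact ⟨(h₀ _).1.trans hss.subset, (h₀ _).2⟩
    · by_cases hvA : v ∈ A
      · obtain ⟨S, hS, hcard, hsub⟩ := h₁' (A.erase v) (fun x hx => by
          have hxA := mem_of_mem_erase hx
          refine mem_sdiff.2 ⟨erase_subset_erase v hA hx, fun h => ?_⟩
          exact hind v hvA x hxA (mem_filter.1 h).2) (fun x hx y hy =>
            hind x (mem_of_mem_erase hx) y (mem_of_mem_erase hy))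
        have hvS : v ∉ S := fun h => (mem_erase.1 (hS h)).1 rfl
        refine ⟨insert v S, insert_subset hvA (hS.trans (erase_subset _ _)), ?_, ?_⟩
        · rw [card_insert_of_notMem hvS, add_mul, one_mul]
          have h1 : (F.erase v \ F.filter (r v)).card ≤ (F \ F.filter (r v)).card :=
            card_le_card (sdiff_subset_sdiff hss.subset le_rfl)
          have h2 := card_sdiff_add_card_eq_card (filter_subset (r v) F)
          omega
        · simp only [mem_insert_self, if_true, erase_insert hvS]
          intro x hx
          by_cases hxv : x = v
          · simp [hxv]
          · have := hsub (mem_erase.2 ⟨hxv, hx⟩)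
            rw [mem_union] at this ⊢
            exact this.imp_right fun h => mem_insert_of_mem h
      · obtain ⟨S, hS, hcard, hsub⟩ := h₀' A (fun x hx =>
          mem_erase.2 ⟨fun h => hvA (h ▸ hx), hA hx⟩) hind
        refine ⟨S, hS, hcard.trans (card_le_card hss.subset), ?_⟩
        simpa only [if_neg fun h => hvA (hS h)] using hsub
  · push Not at hF
    exact ⟨fun _ => F, fun S => ⟨Subset.rfl, hF⟩, fun A hA _ =>
      ⟨∅, empty_subset _, by simp, by simpa using hA⟩⟩

section Step

variable {G : Type*} [AddCommGroup G]

/-- The number of `y ∈ F` with `y + t ∈ F`. -/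
noncomputable def schurDegree (F : Finset G) (t : G) : ℕ :=
  (F.filter fun y => y + t ∈ F).card

theorem card_schurPairs_eq (F : Finset G) :
    (schurPairs F).card = ∑ t ∈ F, schurDegree F t := by
  rw [schurPairs, card_filter, sum_product]
  refine sum_congr rfl fun t _ => ?_
  rw [schurDegree, card_filter]
  simp only [add_comm]

theorem schurDegree_le (F C : Finset G) (t : G) :
    schurDegree F t ≤ schurDegree C t + 2 * (F \ C).card := by
  have hsub : (F.filter fun y => y + t ∈ F) ⊆ (C.filter fun y => y + t ∈ C) ∪
      ((F \ C) ∪ (F \ C).image (· - t)) := by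
    intro y hy
    obtain ⟨hy, hyt⟩ := mem_filter.1 hy
    simp only [mem_union, mem_filter, mem_sdiff, mem_image]
    by_cases h1 : y ∈ C
    · by_cases h2 : y + t ∈ C
      · exact Or.inl ⟨h1, h2⟩
      · exact Or.inr (Or.inr ⟨y + t, ⟨hyt, h2⟩, by abel⟩)
    · exact Or.inr (Or.inl ⟨hy, h1⟩)
  refine (card_le_card hsub).trans ((card_union_le _ _).trans ?_)
  have h1 := card_union_le (F \ C) ((F \ C).image (· - t))
  have h2 := card_image_le (s := F \ C) (f := (· - t))
  unfold schurDegree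
  omega

theorem sum_schurDegree_le [Fintype G] {C T : Finset G} {d : ℕ}
    (hC : ∀ v ∈ C, (C.filter fun z => z - v ∈ T).card < d) :
    ∑ t ∈ T, schurDegree C t ≤ Fintype.card G * d := by
  have h1 : ∑ t ∈ T, schurDegree C t = ∑ y ∈ C, (T.filter fun t => y + t ∈ C).card := by
    simp only [schurDegree, card_filter]
    exact sum_comm
  rw [h1]
  have h2 : ∀ y ∈ C, (T.filter fun t => y + t ∈ C).card ≤ d := by
    intro y hy
    refine le_trans ?_ (hC y hy).le
    refine card_le_card_of_injOn (y + ·) (fun t ht => ?_) (add_right_injective y).injOn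
    have := mem_filter.1 ht
    simp only [coe_filter, Set.mem_ofPred_eq, add_sub_cancel_left]
    exact ⟨this.2, this.1⟩
  refine (sum_le_card_nsmul C _ d h2).trans ?_
  rw [smul_eq_mul]
  exact Nat.mul_le_mul_right _ (card_le_univ C)

end Step

set_option maxHeartbeats 800000 in
/-- A set with many Schur triples can be replaced, as a container of sum-free sets, by few
substantially smaller sets. -/
theorem exists_smaller_containers (δ : ℝ) (hδ : 0 < δ) (γ : ℝ) (hγ : 0 < γ) :
    ∃ N : ℕ, ∀ (G : Type u) [AddCommGroup G] [Fintype G], N ≤ Fintype.card G →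
      ∀ F : Finset G, δ * (Fintype.card G : ℝ) ^ 2 < (schurPairs F).card →
      ∃ 𝓕 : Finset (Finset G), (𝓕.card : ℝ) ≤ (2 : ℝ) ^ (γ * Fintype.card G) ∧
        (∀ F' ∈ 𝓕, (F'.card : ℝ) ≤ F.card - δ / 16 * Fintype.card G) ∧
        ∀ A ⊆ F, IsSumFree A → ∃ F' ∈ 𝓕, A ⊆ F' := by
  obtain ⟨τ, hτ, hsmall⟩ := exists_card_small_subsets_le.{u} (γ / 3) (by positivity)
  -- Fingerprints have at most `n / d` elements, hence at most `τ n` and `δ n / 16`. Below, `q ≥ 4d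
  -- / δ` makes the Schur degrees of `q` heavy elements outweigh the edges left in a sparse
  -- container; `N` makes `q` itself at most `τ n` and `δ n / 4`, and absorbs a constant factor in
  -- the count.
  obtain ⟨d, hd⟩ := exists_nat_ge (max (1 / τ) (16 / δ))
  have hd1 : 1 / τ ≤ d := (le_max_left _ _).trans hd
  have hd2 : 16 / δ ≤ d := (le_max_right _ _).trans hd
  have hd0 : (0 : ℝ) < d := lt_of_lt_of_le (by positivity) hd1
  obtain ⟨q, hq⟩ := exists_nat_ge (4 * d / δ)
  have hq0 : (0 : ℝ) < q := lt_of_lt_of_le (by positivity) hq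
  rw [div_le_iff₀ hδ] at hq
  obtain ⟨N, hN⟩ := exists_nat_ge (max (max (q / τ) (4 * q / δ)) (3 / γ))
  have hN1 : q / τ ≤ N := (le_max_left _ _).trans ((le_max_left _ _).trans hN)
  have hN2 : 4 * q / δ ≤ N := (le_max_right _ _).trans ((le_max_left _ _).trans hN)
  have hN3 : 3 / γ ≤ N := (le_max_right _ _).trans hN
  rw [div_le_iff₀ hτ] at hN1 hd1
  rw [div_le_iff₀ hδ] at hN2 hd2
  rw [div_le_iff₀ hγ] at hN3
  refine ⟨N, fun G _ _ hG F hF => ?_⟩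
  have hGN : (N : ℝ) ≤ Fintype.card G := by exact_mod_cast hG
  specialize hsmall G
  set n : ℝ := ((Fintype.card G : ℕ) : ℝ) with hn
  have hn0 : 0 < n := by rw [hn]; exact_mod_cast Fintype.card_pos
  set 𝒰 := univ.filter fun U : Finset G => (U.card : ℝ) ≤ τ * n with h𝒰
  choose φ hφ hφ' using fun T : Finset G =>
    exists_container_function (fun y z : G => z - y ∈ T) d F
  set heavy := F.filter fun t => δ / 2 * n ≤ schurDegree F t with hheavy
  set 𝓖 := (𝒰.image fun T => (F \ heavy) ∪ T) ∪
    (𝒰 ×ˢ 𝒰).image (fun x => φ x.1 x.2 ∪ x.2) with h𝓖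
  have hdeg : ∀ t, (schurDegree F t : ℝ) ≤ n := fun t => by
    rw [hn]
    exact_mod_cast card_le_univ _
  have hheavycard : δ / 2 * n ≤ heavy.card := by
    rw [card_schurPairs_eq, ← sum_filter_add_sum_filter_not F
      (fun t => δ / 2 * n ≤ schurDegree F t)] at hF
    push_cast at hF
    have h1 : ∑ t ∈ F.filter (fun t => δ / 2 * n ≤ schurDegree F t), (schurDegree F t : ℝ) ≤
        heavy.card * n := by
      rw [← nsmul_eq_mul]
      exact sum_le_card_nsmul _ _ _ fun t _ => hdeg t
    have h2 : ∑ t ∈ F.filter (fun t => ¬ δ / 2 * n ≤ schurDegree F t), (schurDegree F t : ℝ) ≤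
        n * (δ / 2 * n) := by
      refine (sum_le_card_nsmul _ _ (δ / 2 * n) fun t ht => ?_).trans ?_
      · exact (not_le.1 (mem_filter.1 ht).2).le
      · rw [nsmul_eq_mul]
        refine mul_le_mul_of_nonneg_right ?_ (by positivity)
        rw [hn]
        exact_mod_cast card_le_univ _
    refine le_of_mul_le_mul_right ?_ hn0
    nlinarith
  have hcard𝓖 : (𝓖.card : ℝ) ≤ (2 : ℝ) ^ (γ * n) := by
    set B : ℝ := (2 : ℝ) ^ (γ / 3 * n) with hB
    have hB2 : 2 ≤ B := by
      calc (2 : ℝ) = 2 ^ (1 : ℝ) := by simp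
        _ ≤ B := Real.rpow_le_rpow_of_exponent_le (by norm_num) (by nlinarith)
    have h1 : (𝓖.card : ℝ) ≤ 𝒰.card + 𝒰.card * 𝒰.card := by
      have : 𝓖.card ≤ 𝒰.card + 𝒰.card * 𝒰.card :=
        (card_union_le _ _).trans (Nat.add_le_add card_image_le
          (card_image_le.trans_eq (card_product _ _)))
      exact_mod_cast this
    have h2 : (0 : ℝ) ≤ 𝒰.card := Nat.cast_nonneg _
    have h3 : (2 : ℝ) ^ (γ * n) = B * B * B := by
      rw [hB, ← Real.rpow_add (by norm_num), ← Real.rpow_add (by norm_num)]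
      ring_nf
    rw [h3]
    have h4 : (𝒰.card : ℝ) * 𝒰.card ≤ B * B := mul_le_mul hsmall hsmall h2 (by linarith)
    nlinarith
  refine ⟨𝓖.filter fun F' => (F'.card : ℝ) ≤ F.card - δ / 16 * n,
    le_trans (by exact_mod_cast card_le_card (filter_subset _ _)) hcard𝓖,
    fun F' hF' => (mem_filter.1 hF').2, fun A hAF hA => ?_⟩
  -- With few heavy elements in `A`, all others can be dropped from `F`. With at least `q`, choose
  -- `q` of them as `T`: sum-freeness makes `A` independent in the graph joining `y` to `y + t` for
  -- `t ∈ T`. A container `C` of small degree in that graph must omit at least `δ n / 8` elements of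
  -- `F`.
  rcases lt_or_ge (A ∩ heavy).card q with hcase | hcase
  · have hcase' : ((A ∩ heavy).card : ℝ) ≤ q := by exact_mod_cast hcase.le
    refine ⟨(F \ heavy) ∪ (A ∩ heavy), mem_filter.2 ⟨mem_union_left _ (mem_image.2
      ⟨A ∩ heavy, mem_filter.2 ⟨mem_univ _, by nlinarith⟩, rfl⟩), ?_⟩, ?_⟩
    · have h1 : (((F \ heavy) ∪ (A ∩ heavy)).card : ℝ) ≤ (F \ heavy).card + (A ∩ heavy).card := by
        exact_mod_cast card_union_le _ _
      have h2 : ((F \ heavy).card : ℝ) + heavy.card = F.card := by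
        exact_mod_cast card_sdiff_add_card_eq_card (filter_subset _ F)
      nlinarith
    · intro x hx
      by_cases hxh : x ∈ heavy
      · exact mem_union_right _ (mem_inter.2 ⟨hx, hxh⟩)
      · exact mem_union_left _ (mem_sdiff.2 ⟨hAF hx, hxh⟩)
  · obtain ⟨T, hT, hTq⟩ := exists_subset_card_eq hcase
    obtain ⟨S, hSA, hSd, hAS⟩ := hφ' T A hAF (fun x hx y hy hxy => hA _
      (mem_inter.1 (hT hxy)).1 x hx (by simpa using hy))
    have hSd' : (S.card : ℝ) * d ≤ n := by
      have : S.card * d ≤ Fintype.card G := hSd.trans (card_le_univ F)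
      rw [hn]
      exact_mod_cast this
    have hSτ : (S.card : ℝ) ≤ τ * n := by
      refine le_of_mul_le_mul_right ?_ hd0
      nlinarith
    have hSδ : (S.card : ℝ) ≤ δ / 16 * n := by
      refine le_of_mul_le_mul_right ?_ hd0
      nlinarith
    refine ⟨φ T S ∪ S, mem_filter.2 ⟨mem_union_right _ (mem_image.2 ⟨(T, S), mem_product.2
      ⟨mem_filter.2 ⟨mem_univ _, ?_⟩, mem_filter.2 ⟨mem_univ _, hSτ⟩⟩, rfl⟩), ?_⟩, hAS⟩
    · rw [hTq]
      nlinarith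
    · obtain ⟨hCF, hCd⟩ := hφ T S
      set C := φ T S
      have h1 : (q : ℝ) * (δ / 2 * n) ≤ ∑ t ∈ T, (schurDegree F t : ℝ) := by
        rw [← hTq, ← nsmul_eq_mul]
        exact card_nsmul_le_sum _ _ _ fun t ht => (mem_filter.1 (mem_inter.1 (hT ht)).2).2
      have h2 : ∑ t ∈ T, (schurDegree F t : ℝ) ≤ n * d + q * (2 * (F \ C).card) := by
        have : ∑ t ∈ T, schurDegree F t ≤ Fintype.card G * d + q * (2 * (F \ C).card) := by
          calc ∑ t ∈ T, schurDegree F t ≤ ∑ t ∈ T, (schurDegree C t + 2 * (F \ C).card) :=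
                sum_le_sum fun t _ => schurDegree_le F C t
            _ = ∑ t ∈ T, schurDegree C t + q * (2 * (F \ C).card) := by
                rw [sum_add_distrib, sum_const, hTq, smul_eq_mul]
            _ ≤ _ := Nat.add_le_add_right (sum_schurDegree_le fun v hv => by
                convert hCd v hv) _
        rw [hn]
        exact_mod_cast this
      have h3 : δ / 8 * n ≤ (F \ C).card := by
        refine le_of_mul_le_mul_left ?_ hq0
        have := mul_le_mul_of_nonneg_left hq hn0.le
        linarith
      have h4 : ((F \ C).card : ℝ) + C.card = F.card := by
        exact_mod_cast card_sdiff_add_card_eq_card hCF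
      have h5 : ((C ∪ S).card : ℝ) ≤ C.card + S.card := by
        exact_mod_cast card_union_le _ _
      linarith

/-- The **container theorem** for sum-free sets. -/
theorem exists_containers (δ : ℝ) (hδ : 0 < δ) (γ : ℝ) (hγ : 0 < γ) :
    ∃ N : ℕ, ∀ (G : Type u) [AddCommGroup G] [Fintype G], N ≤ Fintype.card G →
      ∃ 𝓕 : Finset (Finset G), (𝓕.card : ℝ) ≤ (2 : ℝ) ^ (γ * Fintype.card G) ∧
        (∀ F ∈ 𝓕, ((schurPairs F).card : ℝ) ≤ δ * (Fintype.card G : ℝ) ^ 2) ∧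
        ∀ A : Finset G, IsSumFree A → ∃ F ∈ 𝓕, A ⊆ F := by
  -- Each refinement costs `δ n / 16` elements, so after `J > 16 / δ` rounds no container can still
  -- have many Schur pairs.
  obtain ⟨J, hJ⟩ := exists_nat_gt (16 / δ)
  have hJ0 : (0 : ℝ) < J := lt_trans (by positivity) hJ
  rw [div_lt_iff₀ hδ] at hJ
  obtain ⟨N, hN⟩ := exists_smaller_containers.{u} δ hδ (γ / J) (by positivity)
  refine ⟨N, fun G _ _ hG => ?_⟩
  specialize hN G hG
  set n : ℝ := ((Fintype.card G : ℕ) : ℝ) with hn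
  have hn0 : 0 < n := by rw [hn]; exact_mod_cast Fintype.card_pos
  set B : ℝ := (2 : ℝ) ^ (γ / J * n) with hB
  have hB1 : 1 ≤ B := Real.one_le_rpow (by norm_num) (by positivity)
  have key : ∀ j : ℕ, ∃ 𝓕 : Finset (Finset G), (𝓕.card : ℝ) ≤ B ^ j ∧
      (∀ F ∈ 𝓕, ((schurPairs F).card : ℝ) ≤ δ * n ^ 2 ∨
        (F.card : ℝ) ≤ n - j * (δ / 16 * n)) ∧
      ∀ A : Finset G, IsSumFree A → ∃ F ∈ 𝓕, A ⊆ F := by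
    intro j
    induction j with
    | zero =>
      refine ⟨{univ}, by simp, fun F hF => Or.inr ?_, fun A _ => ⟨univ, by simp, subset_univ A⟩⟩
      rw [mem_singleton.1 hF, card_univ, hn]
      simp
    | succ j ih =>
      obtain ⟨𝓕, hcard, hF, hcov⟩ := ih
      have hstep : ∀ F ∈ 𝓕, ∃ 𝓖 : Finset (Finset G), (𝓖.card : ℝ) ≤ B ∧
          (∀ F' ∈ 𝓖, ((schurPairs F').card : ℝ) ≤ δ * n ^ 2 ∨
            (F'.card : ℝ) ≤ n - (j + 1 : ℕ) * (δ / 16 * n)) ∧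
          ∀ A ⊆ F, IsSumFree A → ∃ F' ∈ 𝓖, A ⊆ F' := by
        intro F hF𝓕
        by_cases hs : ((schurPairs F).card : ℝ) ≤ δ * n ^ 2
        · exact ⟨{F}, by simpa using hB1, fun F' hF' => Or.inl (mem_singleton.1 hF' ▸ hs),
            fun A hA _ => ⟨F, by simp, hA⟩⟩
        · obtain ⟨𝓖, h1, h2, h3⟩ := hN F (not_le.1 hs)
          refine ⟨𝓖, h1, fun F' hF' => Or.inr ?_, h3⟩
          have h4 := h2 F' hF'
          have h5 := (hF F hF𝓕).resolve_left hs
          push_cast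
          linarith
      choose! g hg1 hg2 hg3 using hstep
      refine ⟨𝓕.biUnion g, ?_, ?_, ?_⟩
      · calc ((𝓕.biUnion g).card : ℝ) ≤ ∑ F ∈ 𝓕, ((g F).card : ℝ) := by
              exact_mod_cast card_biUnion_le
          _ ≤ 𝓕.card * B := by
              rw [← nsmul_eq_mul]
              exact sum_le_card_nsmul _ _ _ hg1
          _ ≤ B ^ j * B := mul_le_mul_of_nonneg_right hcard (by linarith)
          _ = B ^ (j + 1) := (pow_succ _ _).symm
      · intro F' hF'
        obtain ⟨F, hF𝓕, hF'⟩ := mem_biUnion.1 hF'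
        exact hg2 F hF𝓕 F' hF'
      · intro A hA
        obtain ⟨F, hF𝓕, hAF⟩ := hcov A hA
        obtain ⟨F', hF', hAF'⟩ := hg3 F hF𝓕 A hAF hA
        exact ⟨F', mem_biUnion.2 ⟨F, hF𝓕, hF'⟩, hAF'⟩
  obtain ⟨𝓕, h1, h2, h3⟩ := key J
  refine ⟨𝓕, ?_, fun F hF => (h2 F hF).resolve_right fun hcon => ?_, h3⟩
  · convert h1 using 1
    rw [hB, ← Real.rpow_natCast, ← Real.rpow_mul (by norm_num)]
    congr 1
    field_simp
  · have : (0 : ℝ) ≤ F.card := Nat.cast_nonneg _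
    nlinarith

end Containers

/-! ### Arithmetic of the middle residues -/

section MiddleResidues

theorem card_middleResidues {p k : ℕ} (hk : p = 3 * k + 2) : (middleResidues p k).card = k + 1 := by
  rw [middleResidues, card_image_of_injOn, Nat.card_Icc]
  · omega
  · intro i hi j hj hij
    simp only [coe_Icc, Set.mem_Icc] at hi hj
    have := congrArg ZMod.val hij
    simp only at this
    rwa [ZMod.val_natCast_of_lt (by omega), ZMod.val_natCast_of_lt (by omega)] at this

variable {p k : ℕ} [Fact p.Prime]

theorem mem_middleResidues (hk : p = 3 * k + 2) {x : ZMod p} :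
    x ∈ middleResidues p k ↔ k + 1 ≤ x.val ∧ x.val ≤ 2 * k + 1 := by
  simp only [middleResidues, mem_image, mem_Icc]
  constructor
  · rintro ⟨j, hj, rfl⟩
    rwa [ZMod.val_natCast_of_lt (by omega)]
  · intro h
    exact ⟨x.val, h, ZMod.natCast_zmod_val x⟩

theorem val_add_cases (x y : ZMod p) :
    (x.val + y.val < p ∧ (x + y).val = x.val + y.val) ∨
      (p ≤ x.val + y.val ∧ (x + y).val + p = x.val + y.val) := by
  rcases lt_or_ge (x.val + y.val) p with h | h
  · exact Or.inl ⟨h, ZMod.val_add_of_lt h⟩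
  · exact Or.inr ⟨h, ZMod.val_add_val_of_le h |>.symm⟩

theorem zero_notMem_middleResidues (hk : p = 3 * k + 2) : (0 : ZMod p) ∉ middleResidues p k := by
  rw [mem_middleResidues hk, ZMod.val_zero]
  omega

theorem isSumFree_middleResidues (hk : p = 3 * k + 2) : IsSumFree (middleResidues p k) := by
  intro x hx y hy hxy
  rw [mem_middleResidues hk] at hx hy hxy
  rcases val_add_cases x y with h | h <;> omega

theorem exists_add_mem_middleResidues (hk : p = 3 * k + 2) {x : ZMod p}
    (hx : x ∉ middleResidues p k) : ∃ m ∈ middleResidues p k, m + x ∈ middleResidues p k := by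
  have hlt := ZMod.val_lt x
  rw [mem_middleResidues hk] at hx
  have hval : ∀ j : ℕ, j < p → ((j : ZMod p)).val = j := fun j hj => ZMod.val_natCast_of_lt hj
  rcases le_or_gt x.val k with h | h
  · have h1 := hval (k + 1) (by omega)
    refine ⟨((k + 1 : ℕ) : ZMod p), ?_, ?_⟩ <;> rw [mem_middleResidues hk]
    · omega
    · rcases val_add_cases ((k + 1 : ℕ) : ZMod p) x with h | h <;> omega
  · have h1 := hval (2 * k + 1) (by omega)
    refine ⟨((2 * k + 1 : ℕ) : ZMod p), ?_, ?_⟩ <;> rw [mem_middleResidues hk]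
    · omega
    · rcases val_add_cases ((2 * k + 1 : ℕ) : ZMod p) x with h | h <;> omega

/-- Only one middle residue leaves the set under adding `1`, so by dilation only one leaves it under
adding `t`. For `t ≠ ±1` two do: the two largest or the two smallest. -/
theorem eq_one_or_eq_neg_one_of_mul_mem (hk : p = 3 * k + 2) {t : ZMod p} (ht0 : t ≠ 0)
    (ht : ∀ m, m ∈ middleResidues p k ↔ t * m ∈ middleResidues p k) : t = 1 ∨ t = -1 := by
  have hval : ∀ j : ℕ, j < p → ((j : ZMod p)).val = j := fun j hj => ZMod.val_natCast_of_lt hj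
  have hv := ZMod.val_lt t
  have hv0 : t.val ≠ 0 := fun h => ht0 ((ZMod.val_eq_zero t).1 h)
  have h1 : ((1 : ℕ) : ZMod p).val = 1 := hval 1 (by omega)
  by_cases hv1 : t.val = 1
  · left
    rw [← ZMod.natCast_zmod_val t, hv1, Nat.cast_one]
  by_cases hvp : t.val = 3 * k + 1
  · right
    rw [← ZMod.natCast_zmod_val t, hvp, eq_neg_iff_add_eq_zero]
    have : ((3 * k + 1 + 1 : ℕ) : ZMod p) = 0 :=
      (ZMod.natCast_eq_zero_iff _ _).2 (Dvd.intro 1 (by omega))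
    exact_mod_cast this
  exfalso
  have huniq : ∀ m ∈ middleResidues p k, m + t ∉ middleResidues p k →
      m = t * ((2 * k + 1 : ℕ) : ZMod p) := by
    intro m hm hmt
    have hm' : m = t * (t⁻¹ * m) := (mul_inv_cancel_left₀ ht0 m).symm
    rw [hm'] at hm hmt ⊢
    rw [← ht] at hm
    rw [show t * (t⁻¹ * m) + t = t * (t⁻¹ * m + (1 : ℕ)) by push_cast; ring, ← ht] at hmt
    congr 1
    rw [mem_middleResidues hk] at hm hmt
    rw [← ZMod.natCast_zmod_val (t⁻¹ * m)]
    congr 1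
    rcases val_add_cases (t⁻¹ * m) (1 : ℕ) with h | h <;> omega
  have htwo : ∀ i j : ℕ, i < p → j < p → i ≠ j → (i : ZMod p) ∈ middleResidues p k →
      (j : ZMod p) ∈ middleResidues p k → (i : ZMod p) + t ∉ middleResidues p k →
      (j : ZMod p) + t ∉ middleResidues p k → False := by
    intro i j hi hj hij h1 h2 h3 h4
    have := (huniq _ h1 h3).trans (huniq _ h2 h4).symm
    have := congrArg ZMod.val this
    rw [hval i hi, hval j hj] at this
    exact hij this
  rcases le_or_gt t.val (2 * k + 1) with h | h
  · have a1 := hval (2 * k + 1) (by omega)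
    have a2 := hval (2 * k) (by omega)
    refine htwo (2 * k + 1) (2 * k) (by omega) (by omega) (by omega) ?_ ?_ ?_ ?_ <;>
      rw [mem_middleResidues hk]
    · omega
    · omega
    · rcases val_add_cases ((2 * k + 1 : ℕ) : ZMod p) t with h | h <;> omega
    · rcases val_add_cases ((2 * k : ℕ) : ZMod p) t with h | h <;> omega
  · have a1 := hval (k + 1) (by omega)
    have a2 := hval (k + 2) (by omega)
    refine htwo (k + 1) (k + 2) (by omega) (by omega) (by omega) ?_ ?_ ?_ ?_ <;>
      rw [mem_middleResidues hk]
    · omega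
    · omega
    · rcases val_add_cases ((k + 1 : ℕ) : ZMod p) t with h | h <;> omega
    · rcases val_add_cases ((k + 2 : ℕ) : ZMod p) t with h | h <;> omega

end MiddleResidues

/-! ### Homomorphisms to `ZMod p` and their preimages -/

section Homs

open Classical

variable {G : Type*} [AddCommGroup G] {p k : ℕ} [Fact p.Prime]

theorem surjective_of_ne_zero {ψ : G →+ ZMod p} (hψ : ψ ≠ 0) : Function.Surjective ψ := by
  obtain ⟨x, hx⟩ : ∃ x, ψ x ≠ 0 := by
    by_contra! h
    exact hψ (AddMonoidHom.ext h)
  intro y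
  refine ⟨(y * (ψ x)⁻¹).val • x, ?_⟩
  rw [map_nsmul, nsmul_eq_mul, ZMod.natCast_zmod_val, inv_mul_cancel_right₀ hx]

theorem isSumFree_of_subset_middlePreimage (hk : p = 3 * k + 2) {ψ : G →+ ZMod p} {A : Finset G}
    (hA : ∀ x ∈ A, ψ x ∈ middleResidues p k) : IsSumFree A := by
  intro x hx y hy hxy
  have := hA _ hxy
  rw [map_add] at this
  exact isSumFree_middleResidues hk _ (hA x hx) _ (hA y hy) this

theorem map_nsmul_prime (f : G →+ ZMod p) (x : G) : f (p • x) = 0 := by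
  rw [map_nsmul, nsmul_eq_mul, ZMod.natCast_self, zero_mul]

variable [Fintype G]

/-- The set of `x` that `ψ` maps to the middle residues. -/
noncomputable def middlePreimage (k : ℕ) (ψ : G →+ ZMod p) : Finset G :=
  univ.filter fun x => ψ x ∈ middleResidues p k

theorem mem_middlePreimage {ψ : G →+ ZMod p} {x : G} :
    x ∈ middlePreimage k ψ ↔ ψ x ∈ middleResidues p k := by
  simp [middlePreimage]

theorem card_middlePreimage_mul (hk : p = 3 * k + 2) {ψ : G →+ ZMod p} (hψ : ψ ≠ 0) :
    (middlePreimage k ψ).card * p = (k + 1) * Fintype.card G := by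
  have h := card_filter_hom_mem ψ (surjective_of_ne_zero hψ) (middleResidues p k)
  rw [card_middleResidues hk, ZMod.card] at h
  rw [← h, middlePreimage]
  congr! 3

/-- If `ψ x = 0` but `φ x ≠ 0`, moving along multiples of `x` would bring `φ` to the non-middle
residue `0` while keeping `ψ` fixed. Hence `φ = t ψ` for some `t` preserving the middle residues, so
`t = ±1`. -/
theorem middlePreimage_eq_iff (hk : p = 3 * k + 2) {ψ φ : G →+ ZMod p} (hψ : ψ ≠ 0) (hφ : φ ≠ 0) :
    middlePreimage k ψ = middlePreimage k φ ↔ φ = ψ ∨ φ = -ψ := by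
  have hψs := surjective_of_ne_zero hψ
  have hφs := surjective_of_ne_zero hφ
  constructor
  · intro heq
    have hiff : ∀ x, ψ x ∈ middleResidues p k ↔ φ x ∈ middleResidues p k := fun x => by
      rw [← mem_middlePreimage, heq, mem_middlePreimage]
    have hker : ∀ x, ψ x = 0 → φ x = 0 := by
      intro x hx
      by_contra hne
      have hM : (middleResidues p k).Nonempty := by
        rw [← card_pos, card_middleResidues hk]
        omega
      obtain ⟨m, hm⟩ := hM
      obtain ⟨y, rfl⟩ := hψs m
      have h1 : ψ (y + (-φ y * (φ x)⁻¹).val • x) ∈ middleResidues p k := by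
        rwa [map_add, map_nsmul, hx, smul_zero, add_zero]
      rw [hiff, map_add, map_nsmul, nsmul_eq_mul, ZMod.natCast_zmod_val,
        inv_mul_cancel_right₀ hne, add_neg_cancel] at h1
      exact zero_notMem_middleResidues hk h1
    obtain ⟨x₀, hx₀⟩ := hψs 1
    have hmul : ∀ x, φ x = φ x₀ * ψ x := by
      intro x
      have := hker (x - (ψ x).val • x₀) (by
        rw [map_sub, map_nsmul, hx₀, nsmul_eq_mul, ZMod.natCast_zmod_val, mul_one, sub_self])
      rw [map_sub, map_nsmul, nsmul_eq_mul, ZMod.natCast_zmod_val, sub_eq_zero] at this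
      rw [this, mul_comm]
    have ht0 : φ x₀ ≠ 0 := fun h => hφ (AddMonoidHom.ext fun x => by rw [hmul, h, zero_mul]; rfl)
    have ht := eq_one_or_eq_neg_one_of_mul_mem hk ht0 (fun m => by
      obtain ⟨y, rfl⟩ := hψs m
      rw [hiff, hmul])
    rcases ht with ht | ht
    · left
      ext x
      rw [hmul, ht, one_mul]
    · right
      ext x
      rw [hmul, ht, neg_one_mul]
      rfl
  · have hneg : ∀ x : ZMod p, x ∈ middleResidues p k ↔ -x ∈ middleResidues p k := by
      have : ∀ x : ZMod p, x ∈ middleResidues p k → -x ∈ middleResidues p k := by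
        intro x hx
        have hx0 : x ≠ 0 := fun h => zero_notMem_middleResidues hk (h ▸ hx)
        have : NeZero x := ⟨hx0⟩
        rw [mem_middleResidues hk] at hx ⊢
        rw [ZMod.val_neg_of_ne_zero]
        omega
      exact fun x => ⟨this x, fun h => by simpa using this _ h⟩
    rintro (rfl | rfl)
    · rfl
    · ext x
      rw [mem_middlePreimage, mem_middlePreimage, hneg]
      rfl

/-- A nonempty difference of preimages contains a coset of the common kernel of `ψ` and `φ`, whose
index is at most `p ^ 2`. -/
theorem card_le_mul_card_sdiff (hk : p = 3 * k + 2) {ψ φ : G →+ ZMod p} (hψ : ψ ≠ 0) (hφ : φ ≠ 0)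
    (hne : middlePreimage k ψ ≠ middlePreimage k φ) :
    Fintype.card G ≤ p ^ 2 * (middlePreimage k ψ \ middlePreimage k φ).card := by
  have hp : 0 < p := (Fact.out : p.Prime).pos
  obtain ⟨x, hx⟩ : (middlePreimage k ψ \ middlePreimage k φ).Nonempty := by
    rw [sdiff_nonempty]
    intro hsub
    refine hne (eq_of_subset_of_card_le hsub ?_)
    refine le_of_mul_le_mul_right ?_ hp
    rw [card_middlePreimage_mul hk hψ, card_middlePreimage_mul hk hφ]
  set f : G →+ ZMod p × ZMod p := ψ.prod φ with hf
  have hsub : cosetHull f.ker {x} ⊆ middlePreimage k ψ \ middlePreimage k φ := by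
    intro y hy
    rw [mem_cosetHull_singleton, AddMonoidHom.mem_ker, map_sub, sub_eq_zero] at hy
    simp only [hf, AddMonoidHom.prod_apply, Prod.mk.injEq] at hy
    rw [mem_sdiff, mem_middlePreimage, mem_middlePreimage] at hx ⊢
    rwa [hy.1, hy.2]
  have h1 := card_le_card hsub
  rw [card_cosetHull_singleton] at h1
  have h2 := AddSubgroup.card_mul_index f.ker
  rw [AddSubgroup.index_ker, Nat.card_eq_fintype_card (α := G)] at h2
  have h3 : Nat.card f.range ≤ p ^ 2 := by
    refine (AddSubgroup.card_le_card_addGroup f.range).trans_eq ?_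
    rw [Nat.card_eq_fintype_card, Fintype.card_prod, ZMod.card, sq]
  calc Fintype.card G = Nat.card f.ker * Nat.card f.range := h2.symm
    _ ≤ _ * p ^ 2 := Nat.mul_le_mul h1 h3
    _ = _ := mul_comm _ _

/-- Homomorphisms to `ℤ/pℤ` factor through the quotient by the multiples of `p`. -/
noncomputable def homQuotientEquiv :
    (G →+ ZMod p) ≃ ((G ⧸ (nsmulAddMonoidHom (α := G) p).range) →+ ZMod p) where
  toFun f := QuotientAddGroup.lift _ f (by
    rintro _ ⟨x, rfl⟩
    exact map_nsmul_prime f x)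
  invFun g := g.comp (QuotientAddGroup.mk' _)
  left_inv f := by
    ext x
    rfl
  right_inv g := by
    ext x
    rfl

theorem natCard_dual_zmod (Q : Type*) [AddCommGroup Q] [Finite Q] [Module (ZMod p) Q] :
    Nat.card (Q →ₗ[ZMod p] ZMod p) = Nat.card Q := by
  have h := Module.natCard_eq_pow_finrank (K := ZMod p) (V := Q →ₗ[ZMod p] ZMod p)
  rw [h, Module.natCard_eq_pow_finrank (K := ZMod p) (V := Q)]
  congr 1
  exact Subspace.dual_finrank_eq

theorem card_hom_of_forall_nsmul_eq_zero {Q : Type*} [AddCommGroup Q] [Finite Q]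
    (h : ∀ x : Q, p • x = 0) : Nat.card (Q →+ ZMod p) = Nat.card Q := by
  let _ : Module (ZMod p) Q := AddCommGroup.zmodModule h
  rw [Nat.card_congr (AddMonoidHom.toZModLinearMapEquiv p).toEquiv]
  exact natCard_dual_zmod Q

/-- Homomorphisms to `ZMod p` form the dual of the vector space `G / pG`, which has as many elements
as the kernel of multiplication by `p`. The extra `1` is the zero homomorphism. -/
theorem natCard_hom : Nat.card (G →+ ZMod p) = numOrder p G + 1 := by
  set f : G →+ G := nsmulAddMonoidHom p with hf
  rw [Nat.card_congr homQuotientEquiv, card_hom_of_forall_nsmul_eq_zero (by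
    intro x
    obtain ⟨x, rfl⟩ := QuotientAddGroup.mk_surjective x
    rw [← QuotientAddGroup.mk_nsmul, QuotientAddGroup.eq_zero_iff]
    exact ⟨x, rfl⟩)]
  have h1 := AddSubgroup.card_mul_index f.ker
  have h2 := AddSubgroup.card_eq_card_quotient_mul_card_addSubgroup f.range
  rw [AddSubgroup.index_ker, h2] at h1
  have h3 : Nat.card f.ker = Nat.card (G ⧸ f.range) :=
    Nat.eq_of_mul_eq_mul_right Nat.card_pos h1
  rw [← h3, numOrder]
  have h4 : (univ.filter fun g : G => g ∈ f.ker) =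
      insert 0 (univ.filter fun g : G => addOrderOf g = p) := by
    ext g
    simp only [mem_filter, mem_univ, true_and, mem_insert, AddMonoidHom.mem_ker]
    rw [addOrderOf_eq_prime_iff]
    change p • g = 0 ↔ _
    by_cases hg : g = 0
    · simp [hg]
    · simp [hg]
  rw [← card_insert_of_notMem (a := (0 : G)), ← h4, Nat.card_eq_fintype_card,
    Fintype.card_subtype]
  simp only [mem_filter, mem_univ, true_and, addOrderOf_zero]
  exact (Fact.out : p.Prime).one_lt.ne

theorem numOrder_pos (hp : p ∣ Fintype.card G) : 0 < numOrder p G := by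
  obtain ⟨x, hx⟩ := exists_prime_addOrderOf_dvd_card p hp
  exact card_pos.2 ⟨x, by simpa using hx⟩

theorem numOrder_lt_card : numOrder p G < Fintype.card G := by
  refine card_lt_univ_of_notMem (x := 0) ?_
  simp only [mem_filter, mem_univ, true_and, addOrderOf_zero]
  exact (Fact.out : p.Prime).one_lt.ne

end Homs

/-! ### Counting sum-free sets near a preimage -/

section Counting

open Classical

universe u

variable {G : Type*} [AddCommGroup G]

/-- `T` contains none of the pairs `{y, y + x}` with `y ∈ Y`. -/
def AvoidsPairs (x : G) (Y T : Finset G) : Prop :=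
  ∀ y ∈ Y, ¬ (y ∈ T ∧ y + x ∈ T)

/-- If the pairs `{y, y + x}`, `y ∈ Y`, are disjoint, then few subsets of `S` contain none of
them. -/
theorem card_avoiding_pairs_le (x : G) (Y : Finset G) : ∀ S : Finset G, Y ⊆ S →
    Y.image (· + x) ⊆ S → Disjoint Y (Y.image (· + x)) →
    (S.powerset.filter (AvoidsPairs x Y)).card * 4 ^ Y.card ≤
      3 ^ Y.card * 2 ^ S.card := by
  induction Y using Finset.induction_on with
  | empty => intro S _ _ _; simpa using card_filter_le S.powerset (AvoidsPairs x ∅)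
  | insert y Y hy ih =>
    intro S hYS hYxS hdisj
    rw [image_insert] at hYxS hdisj
    have hyx : y ≠ y + x := fun h =>
      Finset.disjoint_left.1 hdisj (mem_insert_self y Y) (by rw [← h]; exact mem_insert_self _ _)
    have hyxY : y + x ∉ Y := fun h =>
      Finset.disjoint_left.1 hdisj (mem_insert_of_mem h) (mem_insert_self _ _)
    have hyYx : y ∉ Y.image (· + x) := fun h =>
      Finset.disjoint_left.1 hdisj (mem_insert_self y Y) (mem_insert_of_mem h)
    have hyxYx : y + x ∉ Y.image (· + x) := by
      intro h
      obtain ⟨z, hz, hzy⟩ := mem_image.1 h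
      exact hy (add_right_cancel hzy ▸ hz)
    have hpair : ({y, y + x} : Finset G) ⊆ S := by
      rw [insert_subset_iff, singleton_subset_iff]
      exact ⟨hYS (mem_insert_self _ _), hYxS (mem_insert_self _ _)⟩
    have hsub : ∀ {Z : Finset G}, Z ⊆ S → y ∉ Z → y + x ∉ Z → Z ⊆ S \ {y, y + x} := by
      intro Z hZ h1 h2 z hz
      rw [mem_sdiff, mem_insert, mem_singleton, not_or]
      exact ⟨hZ hz, fun h => h1 (h ▸ hz), fun h => h2 (h ▸ hz)⟩
    have h := ih (S \ {y, y + x}) (hsub ((subset_insert _ _).trans hYS) hy hyxY)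
      (hsub ((subset_insert _ _).trans hYxS) hyYx hyxYx)
      (hdisj.mono (subset_insert _ _) (subset_insert _ _))
    have hS := card_sdiff_add_card_eq_card hpair
    rw [card_pair hyx] at hS
    set 𝒩 := (S \ {y, y + x}).powerset.filter (AvoidsPairs x Y) with h𝒩
    -- On each forbidden pair only three of the four traces are allowed, giving a factor `3/4` per
    -- pair.
    have hle : (S.powerset.filter (AvoidsPairs x (insert y Y))).card ≤
        𝒩.card * 3 := by
      calc _ ≤ (𝒩 ×ˢ ({∅, {y}, {y + x}} : Finset (Finset G))).card := by
            refine card_le_card_of_injOn (fun T => (T \ {y, y + x}, T ∩ {y, y + x})) ?_ ?_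
            · intro T hT
              rw [mem_coe, mem_filter, mem_powerset] at hT
              rw [mem_coe, mem_product]
              refine ⟨mem_filter.2 ⟨mem_powerset.2 (sdiff_subset_sdiff hT.1 le_rfl), ?_⟩, ?_⟩
              · rintro z hz ⟨h1, h2⟩
                exact hT.2 z (mem_insert_of_mem hz) ⟨(mem_sdiff.1 h1).1, (mem_sdiff.1 h2).1⟩
              · have hnot := hT.2 y (mem_insert_self _ _)
                simp only [mem_insert, mem_singleton]
                by_cases h1 : y ∈ T
                · have h2 : y + x ∉ T := fun h2 => hnot ⟨h1, h2⟩
                  right; left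
                  rw [inter_insert_of_mem h1, inter_singleton_of_notMem h2]
                  rfl
                · rw [inter_insert_of_notMem h1]
                  by_cases h2 : y + x ∈ T
                  · right; right
                    rw [inter_singleton_of_mem h2]
                  · left
                    rw [inter_singleton_of_notMem h2]
            · intro T _ T' _ heq
              simp only [Prod.mk.injEq] at heq
              rw [← sdiff_union_inter T {y, y + x}, heq.1, heq.2, sdiff_union_inter]
        _ ≤ 𝒩.card * 3 := by
            rw [card_product]
            exact Nat.mul_le_mul_left _ card_le_three
    rw [card_insert_of_notMem hy, ← hS, pow_succ, pow_succ, pow_add]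
    calc _ ≤ 𝒩.card * 3 * (4 ^ Y.card * 4) := Nat.mul_le_mul_right _ hle
      _ = 𝒩.card * 4 ^ Y.card * 12 := by ring
      _ ≤ 3 ^ Y.card * 2 ^ (S \ {y, y + x}).card * 12 := Nat.mul_le_mul_right _ h
      _ = _ := by ring

/-- Take `Y` maximal: an element of `R` that cannot be added lies in `Y`, `Y + x` or `Y - x`. -/
theorem exists_disjoint_translate {x : G} (hx : x ≠ 0) (R : Finset G) :
    ∃ Y ⊆ R, Disjoint Y (Y.image (· + x)) ∧ R.card ≤ 3 * Y.card := by
  obtain ⟨Y, hY, hmax⟩ := exists_max_image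
    (R.powerset.filter fun Y => Disjoint Y (Y.image (· + x))) card ⟨∅, by simp⟩
  obtain ⟨hYR, hdisj⟩ := mem_filter.1 hY
  rw [mem_powerset] at hYR
  refine ⟨Y, hYR, hdisj, ?_⟩
  have hsub : R ⊆ Y ∪ Y.image (· + x) ∪ Y.image (· - x) := by
    intro r hr
    by_contra hcon
    simp only [mem_union, not_or] at hcon
    obtain ⟨⟨h1, h2⟩, h3⟩ := hcon
    have hins : insert r Y ∈ R.powerset.filter fun Y => Disjoint Y (Y.image (· + x)) := by
      refine mem_filter.2 ⟨mem_powerset.2 (insert_subset hr hYR), ?_⟩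
      rw [image_insert, disjoint_insert_left, disjoint_insert_right, mem_insert, not_or]
      refine ⟨⟨fun h => hx (by simpa using h), h2⟩, fun h => h3 ?_, hdisj⟩
      exact mem_image.2 ⟨r + x, h, by abel⟩
    have := hmax _ hins
    rw [card_insert_of_notMem h1] at this
    omega
  have h1 := card_le_card hsub
  have h2 := card_union_le (Y ∪ Y.image (· + x)) (Y.image (· - x))
  have h3 := card_union_le Y (Y.image (· + x))
  have h4 := card_image_le (s := Y) (f := (· + x))
  have h5 := card_image_le (s := Y) (f := (· - x))
  omega

/-- Count for each `S` only the subsets contained in no other member of the family; these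
collections are disjoint, and each loses at most `|𝒮| b` sets. -/
theorem card_mul_two_pow_sub_le_card_biUnion {V : Type*} {𝒮 : Finset (Finset V)} {s : ℕ} {b : ℝ}
    (hs : ∀ S ∈ 𝒮, S.card = s)
    (hb : ∀ S ∈ 𝒮, ∀ S' ∈ 𝒮, S ≠ S' → (2 : ℝ) ^ (S ∩ S').card ≤ b) (hb0 : 0 ≤ b) :
    𝒮.card * (2 : ℝ) ^ s - 𝒮.card * (𝒮.card * b) ≤ (𝒮.biUnion powerset).card := by
  set own : Finset V → Finset (Finset V) := fun S =>
    S.powerset \ (𝒮.erase S).biUnion fun S' => (S ∩ S').powerset with hown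
  have hdisj : (𝒮 : Set (Finset V)).PairwiseDisjoint own := by
    intro S hS S' hS' hne
    rw [Function.onFun, Finset.disjoint_left]
    intro T hT hT'
    obtain ⟨h1, h2⟩ := mem_sdiff.1 hT
    obtain ⟨h3, -⟩ := mem_sdiff.1 hT'
    apply h2
    rw [mem_biUnion]
    exact ⟨S', mem_erase.2 ⟨hne.symm, hS'⟩,
      mem_powerset.2 (subset_inter (mem_powerset.1 h1) (mem_powerset.1 h3))⟩
  have hsub : 𝒮.biUnion own ⊆ 𝒮.biUnion powerset :=
    biUnion_mono fun S _ => sdiff_subset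
  have hcard : ∀ S ∈ 𝒮, (2 : ℝ) ^ s - 𝒮.card * b ≤ (own S).card := by
    intro S hS
    have h1 : ((𝒮.erase S).biUnion fun S' => (S ∩ S').powerset).card ≤
        ∑ S' ∈ 𝒮.erase S, (S ∩ S').powerset.card := card_biUnion_le
    have h2 : (((𝒮.erase S).biUnion fun S' => (S ∩ S').powerset).card : ℝ) ≤ 𝒮.card * b := by
      calc _ ≤ ∑ S' ∈ 𝒮.erase S, ((S ∩ S').powerset.card : ℝ) := by exact_mod_cast h1
        _ ≤ (𝒮.erase S).card • b := sum_le_card_nsmul _ _ _ fun S' hS' => by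
            rw [card_powerset]
            push_cast
            exact hb S hS S' (mem_of_mem_erase hS') (ne_of_mem_erase hS').symm
        _ ≤ 𝒮.card * b := by
            rw [nsmul_eq_mul]
            refine mul_le_mul_of_nonneg_right ?_ hb0
            exact_mod_cast card_le_card (erase_subset _ _)
    have h3 := le_card_sdiff ((𝒮.erase S).biUnion fun S' => (S ∩ S').powerset) S.powerset
    rw [card_powerset, hs S hS] at h3
    have h4 : (2 : ℝ) ^ s ≤ (own S).card +
        ((𝒮.erase S).biUnion fun S' => (S ∩ S').powerset).card := by
      have : 2 ^ s ≤ (own S).card +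
        ((𝒮.erase S).biUnion fun S' => (S ∩ S').powerset).card := by
        simp only [hown]
        omega
      exact_mod_cast this
    linarith
  calc 𝒮.card * (2 : ℝ) ^ s - 𝒮.card * (𝒮.card * b)
      = 𝒮.card • ((2 : ℝ) ^ s - 𝒮.card * b) := by rw [nsmul_eq_mul]; ring
    _ ≤ ∑ S ∈ 𝒮, ((own S).card : ℝ) := card_nsmul_le_sum _ _ _ hcard
    _ = ((𝒮.biUnion own).card : ℝ) := by rw [card_biUnion hdisj]; push_cast; rfl
    _ ≤ (𝒮.biUnion powerset).card := by exact_mod_cast card_le_card hsub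

variable [Fintype G] {p k : ℕ} [Fact p.Prime]

/-- Since `ψ x` is not a middle residue, some middle `m` has `m + ψ x` middle as well. The fibre
over `m` has `n / p` elements, so it supplies `n / (3p)` disjoint pairs `{y, y + x}` inside the
preimage. -/
theorem card_avoiding_le (hk : p = 3 * k + 2) {ψ : G →+ ZMod p} (hψ : ψ ≠ 0) {x : G} (hx : x ≠ 0)
    (hxψ : x ∉ middlePreimage k ψ) :
    (((middlePreimage k ψ).powerset.filter fun T => ∀ y ∈ T, y + x ∉ T).card : ℝ) ≤
      (3 / 4 : ℝ) ^ ((Fintype.card G : ℝ) / (3 * p)) * 2 ^ (middlePreimage k ψ).card := by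
  have hp : 0 < p := (Fact.out : p.Prime).pos
  rw [mem_middlePreimage] at hxψ
  obtain ⟨m, hm, hmx⟩ := exists_add_mem_middleResidues hk hxψ
  set R := univ.filter fun y : G => ψ y ∈ ({m} : Finset (ZMod p)) with hR
  have hRcard : R.card * p = Fintype.card G := by
    have h := card_filter_hom_mem ψ (surjective_of_ne_zero hψ) {m}
    rw [card_singleton, one_mul, ZMod.card] at h
    rw [← h, hR]
    congr! 3
  obtain ⟨Y, hYR, hdisj, hYcard⟩ := exists_disjoint_translate hx R
  have hYm : ∀ y ∈ Y, ψ y = m := fun y hy => by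
    have := (mem_filter.1 (hYR hy)).2
    rwa [mem_singleton] at this
  have hmain := card_avoiding_pairs_le x Y (middlePreimage k ψ)
    (fun y hy => mem_middlePreimage.2 (by rwa [hYm y hy])) (fun z hz => by
      obtain ⟨y, hy, rfl⟩ := mem_image.1 hz
      rw [mem_middlePreimage, map_add, hYm y hy]
      exact hmx) hdisj
  set S := middlePreimage k ψ
  have hle : (S.powerset.filter fun T => ∀ y ∈ T, y + x ∉ T).card ≤
      (S.powerset.filter (AvoidsPairs x Y)).card := by
    refine card_le_card fun T hT => ?_
    rw [mem_filter] at hT ⊢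
    exact ⟨hT.1, fun y _ h => hT.2 y h.1 h.2⟩
  have hmain' : ((S.powerset.filter fun T => ∀ y ∈ T, y + x ∉ T).card : ℝ) * 4 ^ Y.card ≤
      3 ^ Y.card * 2 ^ S.card := by
    exact_mod_cast (Nat.mul_le_mul_right _ hle).trans hmain
  have hY : (Fintype.card G : ℝ) / (3 * p) ≤ Y.card := by
    rw [div_le_iff₀ (by positivity)]
    have : Fintype.card G ≤ Y.card * (3 * p) := by
      rw [← hRcard]
      nlinarith
    exact_mod_cast this
  calc _ ≤ (3 / 4 : ℝ) ^ Y.card * 2 ^ S.card := by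
        rw [div_pow, div_mul_eq_mul_div, le_div_iff₀ (by positivity)]
        exact hmain'
    _ ≤ _ := by
        refine mul_le_mul_of_nonneg_right ?_ (by positivity)
        rw [← Real.rpow_natCast]
        exact Real.rpow_le_rpow_of_exponent_ge (by norm_num) (by norm_num) hY

/-- Few sum-free sets are almost, but not completely, contained in a given preimage of the middle
residues. -/
theorem card_sumFree_near_le (hk : p = 3 * k + 2) {ψ : G →+ ZMod p} (hψ : ψ ≠ 0) (τ : ℝ) :
    (((sumFreeSets G).filter fun A => ¬ A ⊆ middlePreimage k ψ ∧
        ((A \ middlePreimage k ψ).card : ℝ) ≤ τ * Fintype.card G).card : ℝ) ≤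
      (univ.filter fun U : Finset G => (U.card : ℝ) ≤ τ * Fintype.card G).card *
        ((3 / 4 : ℝ) ^ ((Fintype.card G : ℝ) / (3 * p)) * 2 ^ (middlePreimage k ψ).card) := by
  set S := middlePreimage k ψ with hS
  set 𝒰 := univ.filter fun U : Finset G => (U.card : ℝ) ≤ τ * Fintype.card G with h𝒰
  set 𝒜 := (sumFreeSets G).filter fun A => ¬ A ⊆ S ∧
    ((A \ S).card : ℝ) ≤ τ * Fintype.card G with h𝒜
  have hmaps : ∀ A ∈ 𝒜, A \ S ∈ 𝒰 := fun A hA =>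
    mem_filter.2 ⟨mem_univ _, (mem_filter.1 hA).2.2⟩
  rw [card_eq_sum_card_fiberwise hmaps]
  push_cast
  rw [← nsmul_eq_mul]
  refine sum_le_card_nsmul _ _ _ fun U hU => ?_
  rcases (𝒜.filter fun A => A \ S = U).eq_empty_or_nonempty with hemp | ⟨A₀, hA₀⟩
  · rw [hemp]
    simp only [card_empty, Nat.cast_zero]
    positivity
  obtain ⟨hA₀𝒜, hA₀U⟩ := mem_filter.1 hA₀
  obtain ⟨hA₀sf, hA₀S, -⟩ := mem_filter.1 hA₀𝒜
  obtain ⟨x, hxA₀, hxS⟩ := not_subset.1 hA₀S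
  have hxU : x ∈ U := hA₀U ▸ mem_sdiff.2 ⟨hxA₀, hxS⟩
  have hsf : ∀ A ∈ sumFreeSets G, IsSumFree A := fun A hA => (mem_filter.1 hA).2
  have hx0 : x ≠ 0 := by
    rintro rfl
    exact hsf _ hA₀sf 0 hxA₀ 0 hxA₀ (by simpa using hxA₀)
  refine le_trans ?_ (card_avoiding_le hk hψ hx0 hxS)
  -- With `U = A \ S` fixed, the element `x ∈ U` belongs to every such `A`, and `A` is determined by
  -- its trace on `S`.
  have : (𝒜.filter fun A => A \ S = U).card ≤
      (S.powerset.filter fun T => ∀ y ∈ T, y + x ∉ T).card := by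
    refine card_le_card_of_injOn (fun A => A ∩ S) ?_ ?_
    · intro A hA
      rw [mem_coe, mem_filter] at hA
      have hxA : x ∈ A := (mem_sdiff.1 (hA.2 ▸ hxU)).1
      have hAsf := hsf _ (mem_filter.1 hA.1).1
      rw [mem_coe, mem_filter, mem_powerset]
      refine ⟨inter_subset_right, fun y hy hyx => ?_⟩
      exact hAsf y (mem_inter.1 hy).1 x hxA (mem_inter.1 hyx).1
    · intro A hA A' hA' heq
      rw [mem_coe, mem_filter] at hA hA'
      simp only at heq
      rw [← sdiff_union_inter A S, hA.2, heq, ← hA'.2, sdiff_union_inter]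
  exact_mod_cast this

end Counting

/-! ### Exceptional sets and the asymptotic count -/

section Main

open Classical

universe u

theorem exists_nat_mul_pow_le {r ε : ℝ} (hr0 : 0 ≤ r) (hr1 : r < 1) (hε : 0 < ε) :
    ∃ N : ℕ, ∀ n : ℕ, N ≤ n → n * r ^ n ≤ ε := by
  have h := tendsto_self_mul_const_pow_of_lt_one hr0 hr1
  obtain ⟨N, hN⟩ := Filter.eventually_atTop.1 (h.eventually_lt_const hε)
  exact ⟨N, fun n hn => (hN n hn).le⟩

theorem mem_exceptionalSumFreeSets {p k : ℕ} {G : Type*} [AddCommGroup G] [Fintype G]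
    {A : Finset G} : A ∈ exceptionalSumFreeSets p k G ↔
      A ∈ sumFreeSets G ∧ ¬ ∃ ψ : G →+ ZMod p, ∀ x ∈ A, ψ x ∈ middleResidues p k := by
  simp only [exceptionalSumFreeSets, mem_filter]

variable {p k : ℕ} [Fact p.Prime]

theorem finite_hom (G : Type*) [AddCommGroup G] [Fintype G] : Finite (G →+ ZMod p) :=
  DFunLike.finite _

theorem exists_card_exceptional_le (hk : p = 3 * k + 2) (ε : ℝ) (hε : 0 < ε) :
    ∃ N : ℕ, ∀ (G : Type u) [AddCommGroup G] [Fintype G], IsTypeI p G → N ≤ Fintype.card G →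
      ∀ s : ℕ, s * p = (k + 1) * Fintype.card G →
        ((exceptionalSumFreeSets p k G).card : ℝ) ≤ ε * 2 ^ s := by
  have hprime : p.Prime := Fact.out
  have hp0 : (0 : ℝ) < p := by exact_mod_cast hprime.pos
  -- `2η` is exactly the gap between the maximal density `(p + 1) / (3p)` and the stability
  -- threshold `(p + 2) / (3 (p + 1))`.
  set η : ℝ := 1 / (6 * p * (p + 1)) with hη
  have hη0 : 0 < η := by positivity
  -- Chosen so that `2 ^ (γ n) = (4/3) ^ (n / (6p))`: the choices outside a preimage use up half of
  -- the gain `(3/4) ^ (n / (3p))`.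
  set γ : ℝ := Real.logb 2 (4 / 3) / (6 * p) with hγ
  have hlogb : 0 < Real.logb 2 (4 / 3) := Real.logb_pos (by norm_num) (by norm_num)
  have hγ0 : 0 < γ := by positivity
  obtain ⟨τ, hτ, hsmall⟩ := exists_card_small_subsets_le.{u} γ hγ0
  obtain ⟨δ, hδ, hremoval⟩ := exists_sumFree_subset_of_card_schurPairs_lt.{u} (min τ (η / 2))
    (lt_min hτ (by positivity))
  obtain ⟨N₁, hN₁⟩ := exists_containers.{u} (δ / 2) (by positivity) (η / 2) (by positivity)
  set r₁ : ℝ := 2 ^ (-(η / 2)) with hr₁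
  set r₂ : ℝ := (3 / 4) ^ (1 / (6 * p) : ℝ) with hr₂
  obtain ⟨N₂, hN₂⟩ := exists_nat_mul_pow_le (r := r₁) (by positivity)
    (Real.rpow_lt_one_of_one_lt_of_neg (by norm_num) (by linarith)) (half_pos hε)
  obtain ⟨N₃, hN₃⟩ := exists_nat_mul_pow_le (r := r₂) (by positivity)
    (Real.rpow_lt_one (by norm_num) (by norm_num) (by positivity)) (half_pos hε)
  refine ⟨max N₁ (max N₂ N₃), fun G _ _ hG hN s hs => ?_⟩
  obtain ⟨𝓕, h𝓕card, h𝓕schur, h𝓕cov⟩ := hN₁ G ((le_max_left _ _).trans hN)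
  specialize hN₂ (Fintype.card G) ((le_max_left _ _).trans ((le_max_right _ _).trans hN))
  specialize hN₃ (Fintype.card G) ((le_max_right _ _).trans ((le_max_right _ _).trans hN))
  specialize hsmall G
  have hn1 : (1 : ℝ) ≤ Fintype.card G := by exact_mod_cast Fintype.card_pos
  set n : ℝ := ((Fintype.card G : ℕ) : ℝ) with hn
  have hn0 : 0 < n := by linarith
  have hs' : (s : ℝ) = (p + 1) / (3 * p) * n := by
    have h1 : (s : ℝ) * p = (k + 1) * n := by rw [hn]; exact_mod_cast hs
    have h2 : (p : ℝ) = 3 * k + 2 := by exact_mod_cast hk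
    field_simp
    rw [h2] at h1 ⊢
    linarith
  have := finite_hom (p := p) G
  let _ : Fintype (G →+ ZMod p) := Fintype.ofFinite _
  set E₁ := (𝓕.filter fun F => (F.card : ℝ) ≤ s - η * n).biUnion powerset with hE₁
  set E₂ := (univ.filter fun ψ : G →+ ZMod p => ψ ≠ 0).biUnion fun ψ =>
    (sumFreeSets G).filter fun A => ¬ A ⊆ middlePreimage k ψ ∧
      ((A \ middlePreimage k ψ).card : ℝ) ≤ τ * n with hE₂
  have hcover : exceptionalSumFreeSets p k G ⊆ E₁ ∪ E₂ := by
    intro A hA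
    obtain ⟨hAsf, hAex⟩ := mem_exceptionalSumFreeSets.1 hA
    obtain ⟨F, hF, hAF⟩ := h𝓕cov A (mem_filter.1 hAsf).2
    -- Small containers go to `E₁`. In a large one, removal deletes at most `η n / 2` elements,
    -- leaving more than `s - 2 η n`, enough for stability; it also deletes at most `τ n`, which
    -- bounds how much of `A` lies outside the preimage.
    rcases le_or_gt (F.card : ℝ) (s - η * n) with hFs | hFs
    · exact mem_union_left _ (mem_biUnion.2 ⟨F, mem_filter.2 ⟨hF, hFs⟩, mem_powerset.2 hAF⟩)
    obtain ⟨B, hBF, hBsf, hBcard⟩ := hremoval G F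
      (lt_of_le_of_lt (h𝓕schur F hF) (by
        rw [← hn]
        have : 0 < δ * n ^ 2 := by positivity
        linarith))
    have h1 : ((F \ B).card : ℝ) + B.card = F.card := by
      exact_mod_cast card_sdiff_add_card_eq_card hBF
    have h2 : min τ (η / 2) * n ≤ η / 2 * n :=
      mul_le_mul_of_nonneg_right (min_le_right _ _) (by linarith)
    have h3 : min τ (η / 2) * n ≤ τ * n :=
      mul_le_mul_of_nonneg_right (min_le_left _ _) (by linarith)
    have hB : (s : ℝ) - 2 * η * n < B.card := by
      have : 0 < η * n := by positivity
      linarith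
    have hB' : (p + 2) * Fintype.card G < 3 * (p + 1) * B.card := by
      have h4 : (s : ℝ) - 2 * η * n = (p + 2) / (3 * (p + 1)) * n := by
        rw [hs', hη]
        field_simp
        ring
      rw [h4, div_mul_eq_mul_div, div_lt_iff₀ (by positivity)] at hB
      have : ((p : ℝ) + 2) * Fintype.card G < 3 * (p + 1) * B.card := by
        rw [← hn]
        linarith
      exact_mod_cast this
    obtain ⟨ψ, hψ⟩ := hBsf.exists_hom hprime hk hG hB'
    have hψ0 : ψ ≠ 0 := by
      rintro rfl
      have hBne : B.Nonempty := by
        rw [← card_pos]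
        by_contra hcon
        have : B.card = 0 := by omega
        rw [this] at hB'
        omega
      obtain ⟨b, hb⟩ := hBne
      exact zero_notMem_middleResidues hk (hψ b hb)
    refine mem_union_right _ (mem_biUnion.2 ⟨ψ, by simpa using hψ0, mem_filter.2
      ⟨hAsf, fun hsub => hAex ⟨ψ, fun x hx => mem_middlePreimage.1 (hsub hx)⟩, ?_⟩⟩)
    have h5 : A \ middlePreimage k ψ ⊆ F \ B := by
      intro x hx
      rw [mem_sdiff, mem_middlePreimage] at hx
      exact mem_sdiff.2 ⟨hAF hx.1, fun hxB => hx.2 (hψ x hxB)⟩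
    have h6 : ((A \ middlePreimage k ψ).card : ℝ) ≤ (F \ B).card := by
      exact_mod_cast card_le_card h5
    linarith
  have hE₁card : (E₁.card : ℝ) ≤ ε / 2 * 2 ^ s := by
    have h1 : (E₁.card : ℝ) ≤ (𝓕.card : ℝ) * 2 ^ ((s : ℝ) - η * n) := by
      calc (E₁.card : ℝ) ≤ ∑ F ∈ 𝓕.filter fun F => (F.card : ℝ) ≤ s - η * n,
            (F.powerset.card : ℝ) := by exact_mod_cast card_biUnion_le
        _ ≤ (𝓕.filter fun F => (F.card : ℝ) ≤ s - η * n).card • (2 : ℝ) ^ ((s : ℝ) - η * n) := by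
            refine sum_le_card_nsmul _ _ _ fun F hF => ?_
            rw [card_powerset]
            push_cast
            rw [← Real.rpow_natCast]
            exact Real.rpow_le_rpow_of_exponent_le (by norm_num) (mem_filter.1 hF).2
        _ ≤ _ := by
            rw [nsmul_eq_mul]
            refine mul_le_mul_of_nonneg_right ?_ (by positivity)
            exact_mod_cast card_le_card (filter_subset _ _)
    calc (E₁.card : ℝ) ≤ 2 ^ (η / 2 * n) * 2 ^ ((s : ℝ) - η * n) :=
          h1.trans (mul_le_mul_of_nonneg_right h𝓕card (by positivity))
      _ = r₁ ^ Fintype.card G * 2 ^ s := by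
          rw [hr₁, ← Real.rpow_natCast, ← Real.rpow_mul (by norm_num), ← Real.rpow_natCast,
            ← Real.rpow_add (by norm_num), ← Real.rpow_add (by norm_num), ← hn]
          ring_nf
      _ ≤ ε / 2 * 2 ^ s := by
          refine mul_le_mul_of_nonneg_right (le_trans ?_ hN₂) (by positivity)
          exact le_mul_of_one_le_left (by positivity) hn1
  have hE₂card : (E₂.card : ℝ) ≤ ε / 2 * 2 ^ s := by
    have hhom : ((univ.filter fun ψ : G →+ ZMod p => ψ ≠ 0).card : ℝ) ≤ n := by
      have h1 := card_le_univ (univ.filter fun ψ : G →+ ZMod p => ψ ≠ 0)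
      rw [← Nat.card_eq_fintype_card, natCard_hom] at h1
      rw [hn]
      exact_mod_cast h1.trans numOrder_lt_card
    have hpow : (2 : ℝ) ^ (γ * n) * (3 / 4 : ℝ) ^ (n / (3 * p)) = r₂ ^ Fintype.card G := by
      have h1 : (2 : ℝ) ^ (γ * n) = (3 / 4 : ℝ) ^ (-(n / (6 * p))) := by
        rw [hγ, div_mul_eq_mul_div, mul_div_assoc, Real.rpow_mul (by norm_num),
          Real.rpow_logb (by norm_num) (by norm_num) (by norm_num), Real.rpow_neg (by norm_num),
          ← Real.inv_rpow (by norm_num)]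
        norm_num
      rw [h1, hr₂, ← Real.rpow_natCast, ← Real.rpow_mul (by norm_num),
        ← Real.rpow_add (by norm_num), ← hn]
      congr 1
      field_simp
      ring
    calc (E₂.card : ℝ) ≤ ∑ ψ ∈ univ.filter fun ψ : G →+ ZMod p => ψ ≠ 0,
            (((sumFreeSets G).filter fun A => ¬ A ⊆ middlePreimage k ψ ∧
              ((A \ middlePreimage k ψ).card : ℝ) ≤ τ * n).card : ℝ) := by
          exact_mod_cast card_biUnion_le
      _ ≤ (univ.filter fun ψ : G →+ ZMod p => ψ ≠ 0).card •
            ((2 : ℝ) ^ (γ * n) * ((3 / 4 : ℝ) ^ (n / (3 * p)) * 2 ^ s)) := by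
          refine sum_le_card_nsmul _ _ _ fun ψ hψ => ?_
          have hψ0 : ψ ≠ 0 := (mem_filter.1 hψ).2
          have hscard : (middlePreimage k ψ).card = s :=
            Nat.eq_of_mul_eq_mul_right hprime.pos ((card_middlePreimage_mul hk hψ0).trans hs.symm)
          have h1 := card_sumFree_near_le hk hψ0 τ
          rw [hscard] at h1
          exact h1.trans (mul_le_mul_of_nonneg_right hsmall (by positivity))
      _ ≤ n * (r₂ ^ Fintype.card G * 2 ^ s) := by
          rw [nsmul_eq_mul, ← hpow, mul_assoc]
          exact mul_le_mul_of_nonneg_right hhom (by positivity)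
      _ ≤ ε / 2 * 2 ^ s := by
          rw [← mul_assoc]
          exact mul_le_mul_of_nonneg_right hN₃ (by positivity)
  have hle : ((exceptionalSumFreeSets p k G).card : ℝ) ≤ E₁.card + E₂.card := by
    exact_mod_cast (card_le_card hcover).trans (card_union_le _ _)
  linarith

variable {G : Type u} [AddCommGroup G] [Fintype G]

/-- The preimages of the middle residues under nonzero homomorphisms. -/
noncomputable def middlePreimages (p k : ℕ) [Fact p.Prime] (G : Type*) [AddCommGroup G]
    [Fintype G] : Finset (Finset G) :=
  univ.filter fun S => ∃ ψ : G →+ ZMod p, ψ ≠ 0 ∧ middlePreimage k ψ = S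

theorem mem_middlePreimages {S : Finset G} :
    S ∈ middlePreimages p k G ↔ ∃ ψ : G →+ ZMod p, ψ ≠ 0 ∧ middlePreimage k ψ = S := by
  simp [middlePreimages]

/-- The map from nonzero homomorphisms to preimages has fibres `{ψ, -ψ}`. These have two elements
for odd `p` and one for `p = 2`, where `ψ = -ψ`. -/
theorem card_middlePreimages (hk : p = 3 * k + 2) :
    ((middlePreimages p k G).card : ℝ) = (if p = 2 then (1 : ℝ) else 1 / 2) * numOrder p G := by
  have := finite_hom (p := p) G
  let _ : Fintype (G →+ ZMod p) := Fintype.ofFinite _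
  set H := univ.filter fun ψ : G →+ ZMod p => ψ ≠ 0 with hH
  have hHcard : H.card = numOrder p G := by
    have h1 : insert 0 H = univ := by
      ext ψ
      by_cases h : ψ = 0 <;> simp [hH, h]
    have h2 := card_insert_of_notMem (s := H) (a := 0) (by simp [hH])
    rw [h1, card_univ, ← Nat.card_eq_fintype_card, natCard_hom] at h2
    omega
  have himage : middlePreimages p k G = H.image (middlePreimage k) := by
    ext S
    simp [mem_middlePreimages, hH]
  have hmemH : ∀ ψ, ψ ∈ H ↔ ψ ≠ 0 := fun ψ => by simp [hH]
  split_ifs with hp2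
  · rw [himage, card_image_of_injOn, hHcard, one_mul]
    intro ψ hψ φ hφ heq
    rcases (middlePreimage_eq_iff hk ((hmemH ψ).1 hψ) ((hmemH φ).1 hφ)).1 heq with h | h
    · exact h.symm
    · rw [h]
      ext x
      have h0 := map_nsmul_prime ψ x
      have h2 : p • x = x + x := by rw [hp2, two_nsmul]
      rw [h2, map_add] at h0
      exact eq_neg_of_add_eq_zero_left h0
  · have hsum := card_eq_sum_card_image (middlePreimage k) H
    have hfiber : ∀ S ∈ H.image (middlePreimage k),
        (H.filter fun ψ => middlePreimage k ψ = S).card = 2 := by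
      intro S hS
      obtain ⟨ψ, hψ, rfl⟩ := mem_image.1 hS
      have hψ0 := (hmemH ψ).1 hψ
      have hne : ψ ≠ -ψ := by
        intro h
        apply hψ0
        ext x
        have h1 : ψ x = -ψ x := DFunLike.congr_fun h x
        have h2 : (2 : ZMod p) ≠ 0 := by
          have : ((2 : ℕ) : ZMod p) ≠ 0 := by
            rw [Ne, ZMod.natCast_eq_zero_iff]
            intro hd
            have := Nat.le_of_dvd (by norm_num) hd
            omega
          exact_mod_cast this
        refine (mul_eq_zero.1 (?_ : 2 * ψ x = 0)).resolve_left h2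
        linear_combination h1
      rw [← card_pair hne]
      congr 1
      ext φ
      simp only [mem_filter, mem_insert, mem_singleton, hmemH]
      constructor
      · rintro ⟨hφ, heq⟩
        exact (middlePreimage_eq_iff hk hψ0 hφ).1 heq.symm
      · intro h
        have hφ : φ ≠ 0 := by
          rcases h with rfl | rfl
          · exact hψ0
          · exact neg_ne_zero.2 hψ0
        exact ⟨hφ, ((middlePreimage_eq_iff hk hψ0 hφ).2 h).symm⟩
    rw [sum_congr rfl hfiber, sum_const, smul_eq_mul, hHcard] at hsum
    rw [himage, hsum]
    push_cast
    ring

theorem sumFreeSets_eq (hk : p = 3 * k + 2) (hne : (middlePreimages p k G).Nonempty) :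
    (sumFreeSets G).card = ((middlePreimages p k G).biUnion powerset).card +
      (exceptionalSumFreeSets p k G).card := by
  have hgood : (sumFreeSets G).filter (fun A => ∃ ψ : G →+ ZMod p, ∀ x ∈ A,
      ψ x ∈ middleResidues p k) = (middlePreimages p k G).biUnion powerset := by
    ext A
    simp only [mem_filter, mem_biUnion, mem_powerset, sumFreeSets, mem_univ, true_and]
    constructor
    · rintro ⟨-, ψ, hψ⟩
      -- The zero homomorphism admits only the empty set, which lies in any preimage; this is where
      -- some preimage must exist.
      by_cases hψ0 : ψ = 0
      · obtain ⟨S, hS⟩ := hne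
        refine ⟨S, hS, fun x hx => ?_⟩
        have := hψ x hx
        rw [hψ0] at this
        exact absurd this (zero_notMem_middleResidues hk)
      · exact ⟨_, mem_middlePreimages.2 ⟨ψ, hψ0, rfl⟩, fun x hx => mem_middlePreimage.2 (hψ x hx)⟩
    · rintro ⟨S, hS, hAS⟩
      obtain ⟨ψ, hψ, rfl⟩ := mem_middlePreimages.1 hS
      have hA : ∀ x ∈ A, ψ x ∈ middleResidues p k := fun x hx => mem_middlePreimage.1 (hAS hx)
      exact ⟨isSumFree_of_subset_middlePreimage hk hA, ψ, hA⟩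
  rw [← hgood, exceptionalSumFreeSets]
  convert (card_filter_add_card_filter_not (s := sumFreeSets G) (fun A =>
    ∃ ψ : G →+ ZMod p, ∀ x ∈ A, ψ x ∈ middleResidues p k)).symm

theorem sup_card_sumFreeSets_mul (hk : p = 3 * k + 2) (hG : IsTypeI p G)
    (hne : (middlePreimages p k G).Nonempty) :
    (sumFreeSets G).sup card * p = (k + 1) * Fintype.card G := by
  obtain ⟨S, hS⟩ := hne
  obtain ⟨ψ, hψ, rfl⟩ := mem_middlePreimages.1 hS
  apply le_antisymm
  · obtain ⟨A, hA, hAsup⟩ := exists_mem_eq_sup (sumFreeSets G)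
      ⟨∅, mem_filter.2 ⟨mem_univ _, fun x hx => absurd hx (notMem_empty x)⟩⟩ card
    rw [hAsup]
    exact (mem_filter.1 hA).2.card_mul_le hk hG
  · rw [← card_middlePreimage_mul hk hψ]
    refine Nat.mul_le_mul_right _ (le_sup (f := card) (mem_filter.2 ⟨mem_univ _, ?_⟩))
    exact isSumFree_of_subset_middlePreimage hk fun x hx => mem_middlePreimage.1 hx

/-- The union bound gives one side. For the other, two distinct preimages meet in at most `s - n / p
^ 2` points, so they share at most `2 ^ s · 2 ^ (-n / p ^ 2)` subsets. -/
theorem abs_card_biUnion_sub_le (hk : p = 3 * k + 2) {s : ℕ}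
    (hs : s * p = (k + 1) * Fintype.card G) :
    |(((middlePreimages p k G).biUnion powerset).card : ℝ) -
        (middlePreimages p k G).card * 2 ^ s| ≤
      (middlePreimages p k G).card * ((middlePreimages p k G).card *
        (2 ^ s * ((2 : ℝ) ^ (-(1 / p ^ 2 : ℝ))) ^ Fintype.card G)) := by
  have hprime : p.Prime := Fact.out
  have hcard : ∀ S ∈ middlePreimages p k G, S.card = s := by
    intro S hS
    obtain ⟨ψ, hψ, rfl⟩ := mem_middlePreimages.1 hS
    exact Nat.eq_of_mul_eq_mul_right hprime.pos ((card_middlePreimage_mul hk hψ).trans hs.symm)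
  have hlow := card_mul_two_pow_sub_le_card_biUnion hcard
    (b := 2 ^ s * ((2 : ℝ) ^ (-(1 / p ^ 2 : ℝ))) ^ Fintype.card G) (by
      intro S hS S' hS' hne
      obtain ⟨ψ, hψ, rfl⟩ := mem_middlePreimages.1 hS
      obtain ⟨φ, hφ, rfl⟩ := mem_middlePreimages.1 hS'
      have h1 := card_le_mul_card_sdiff hk hψ hφ hne
      have h2 := card_sdiff_add_card_inter (middlePreimage k ψ) (middlePreimage k φ)
      rw [hcard _ hS] at h2
      have h1' : (Fintype.card G : ℝ) ≤
          p ^ 2 * (middlePreimage k ψ \ middlePreimage k φ).card := by exact_mod_cast h1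
      have h2' : ((middlePreimage k ψ \ middlePreimage k φ).card : ℝ) +
          (middlePreimage k ψ ∩ middlePreimage k φ).card = s := by exact_mod_cast h2
      have hp2 : (0 : ℝ) < p ^ 2 := by
        have : (0 : ℝ) < p := by exact_mod_cast hprime.pos
        positivity
      rw [← Real.rpow_natCast, ← Real.rpow_natCast, ← Real.rpow_natCast,
        ← Real.rpow_mul (by norm_num), ← Real.rpow_add (by norm_num)]
      refine Real.rpow_le_rpow_of_exponent_le (by norm_num) ?_
      have h3 : (1 / p ^ 2 : ℝ) * Fintype.card G ≤
          (middlePreimage k ψ \ middlePreimage k φ).card := by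
        rw [one_div_mul_eq_div, div_le_iff₀ hp2]
        linarith
      linarith) (by positivity)
  have hup : (((middlePreimages p k G).biUnion powerset).card : ℝ) ≤
      (middlePreimages p k G).card * 2 ^ s := by
    have : ((middlePreimages p k G).biUnion powerset).card ≤
        (middlePreimages p k G).card * 2 ^ s :=
      card_biUnion_le_card_mul _ _ _ fun S hS => by rw [card_powerset, hcard S hS]
    exact_mod_cast this
  rw [abs_le]
  refine ⟨by linarith, ?_⟩
  have : (0 : ℝ) ≤ (middlePreimages p k G).card * ((middlePreimages p k G).card *
        (2 ^ s * ((2 : ℝ) ^ (-(1 / p ^ 2 : ℝ))) ^ Fintype.card G)) := by positivity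
  linarith

end Main

theorem theorem3 (p k : ℕ) (hp : p.Prime) (hk : p = 3 * k + 2) (ε : ℝ) (hε : 0 < ε) :
    ∃ N : ℕ, ∀ (G : Type*) [AddCommGroup G] [Fintype G],
      IsTypeI p G → N ≤ Fintype.card G →
        |((sumFreeSets G).card : ℝ) -
            (if p = 2 then (1 : ℝ) else 1 / 2) * (numOrder p G : ℝ) *
              (2 : ℝ) ^ (sumFreeDensity G * (Fintype.card G : ℝ))| ≤
          ε * ((if p = 2 then (1 : ℝ) else 1 / 2) * (numOrder p G : ℝ) *
              (2 : ℝ) ^ (sumFreeDensity G * (Fintype.card G : ℝ))) ∧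
        ((exceptionalSumFreeSets p k G).card : ℝ) ≤
          ε * (2 : ℝ) ^ (sumFreeDensity G * (Fintype.card G : ℝ)) := by
  have : Fact p.Prime := ⟨hp⟩
  have hp0 : (0 : ℝ) < p := by exact_mod_cast hp.pos
  obtain ⟨N₁, hN₁⟩ := exists_card_exceptional_le hk (ε / 2) (half_pos hε)
  obtain ⟨N₂, hN₂⟩ := exists_nat_mul_pow_le (r := (2 : ℝ) ^ (-(1 / p ^ 2 : ℝ))) (by positivity)
    (Real.rpow_lt_one_of_one_lt_of_neg (by norm_num) (neg_neg_of_pos (by positivity)))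
    (half_pos hε)
  refine ⟨max N₁ N₂, fun G _ _ hG hN => ?_⟩
  specialize hN₂ (Fintype.card G) ((le_max_right _ _).trans hN)
  have hcard := card_middlePreimages (G := G) hk
  have hord := numOrder_pos (p := p) (G := G) hG.1.2.2
  have hWpos : (0 : ℝ) < (middlePreimages p k G).card := by
    rw [hcard]
    have : (0 : ℝ) < numOrder p G := by exact_mod_cast hord
    split_ifs <;> positivity
  have hpos : 0 < (middlePreimages p k G).card := by exact_mod_cast hWpos
  have hle : ((middlePreimages p k G).card : ℝ) ≤ Fintype.card G := by
    have h1 : (numOrder p G : ℝ) ≤ Fintype.card G := by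
      exact_mod_cast numOrder_lt_card.le
    have h2 : (0 : ℝ) ≤ numOrder p G := Nat.cast_nonneg _
    rw [hcard]
    split_ifs <;> linarith
  have hne := card_pos.1 hpos
  have hs := sup_card_sumFreeSets_mul hk hG hne
  have hex := hN₁ G hG ((le_max_left _ _).trans hN) _ hs
  have hdens : sumFreeDensity G * (Fintype.card G : ℝ) =
      (((sumFreeSets G).sup card : ℕ) : ℝ) := by
    rw [sumFreeDensity]
    exact div_mul_cancel₀ _ (by exact_mod_cast Fintype.card_ne_zero)
  have habs := abs_card_biUnion_sub_le hk hs
  rw [hdens, Real.rpow_natCast, ← hcard, sumFreeSets_eq hk hne]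
  set s := (sumFreeSets G).sup card
  set m : ℝ := ((middlePreimages p k G).card : ℝ)
  set E : ℝ := ((exceptionalSumFreeSets p k G).card : ℝ)
  have hs2 : (0 : ℝ) < 2 ^ s := by positivity
  have hm1 : 1 ≤ m := Nat.one_le_cast.2 hpos
  have hE0 : 0 ≤ E := Nat.cast_nonneg _
  -- One factor `m` is at most `n` and is absorbed by the exponential decay; the other belongs to
  -- the main term.
  have hbound : m * (m * (2 ^ s * ((2 : ℝ) ^ (-(1 / p ^ 2 : ℝ))) ^ Fintype.card G)) ≤
      ε / 2 * (m * 2 ^ s) := by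
    calc _ = m * ((2 : ℝ) ^ (-(1 / p ^ 2 : ℝ))) ^ Fintype.card G * (m * 2 ^ s) := by ring
      _ ≤ _ := by
        refine mul_le_mul_of_nonneg_right (le_trans ?_ hN₂) (by positivity)
        exact mul_le_mul_of_nonneg_right hle (by positivity)
  have hE : E ≤ ε / 2 * (m * 2 ^ s) := by
    refine hex.trans (mul_le_mul_of_nonneg_left ?_ (half_pos hε).le)
    exact le_mul_of_one_le_left hs2.le hm1
  refine ⟨?_, hex.trans (mul_le_mul_of_nonneg_right (by linarith) hs2.le)⟩
  rw [abs_le] at habs ⊢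
  push_cast
  constructor <;> linarith
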